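/- Let $\mathcal{A}$ be a von Neumann algebra acting on a complex Hilbert space $\mathcal{H}$ and let $\tau$ be a faithful normal trace state on $\mathcal{A}$. Let $n\in\mathbb{N}$ and let $M_n(\mathcal{A})=M_n(\mathbb{C})\otimes\mathcal{A}$ act on $\mathcal{H}^n$. For $a=[a_{ij}]\in M_n(\mathcal{A})$ put $$\tau_n(a)=\frac1n\sum_{j=1}^n\tau(a_{jj}),\qquad E_n(a)=[\tau(a_{ij})]_{i,j=1}^n\in M_n(\mathbb{C})\cong M_n(\mathbb{C})\otimes 1_{\mathcal{A}}.$$ Let $X$ be a (possibly unbounded) selfadjoint operator on $\mathcal{H}^n$ affiliated with $M_n(\mathcal{A})$, that is, such that $(i1-X)^{-1}\in M_n(\mathcal{A})$. For a closed operator $Y$ on $\mathcal{H}^n$, $\ker Y$ denotes the greatest projection $p\in M_n(\mathcal{A})$ such that $Yp=0$. Then there exist projections $q_1,q_2\in M_n(\mathbb{C})\otimes 1_{\mathcal{A}}$ such that the compositions $q_1Xq_2$ and $q_2Xq_1$ are densely defined and closable and, denoting their closures again by $q_1Xq_2$ and $q_2Xq_1$, the projections $\ker X$, $\ker(q_1Xq_2)$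 and $\ker(q_2Xq_1)$ exist and satisfy: 1. $E_n(\ker(q_1Xq_2))$ and $E_n(\ker(q_2Xq_1))$ are invertible; 2. $n\tau_n(\ker(q_1Xq_2))-n\tau_n(\ker X)=n\tau_n(\ker(q_2Xq_1))-n\tau_n(\ker X)$, and this common value is an integer. -/

import Mathlib

noncomputable section

namespace TracialVN

universe u

variable {H : Type u} [NormedAddCommGroup H] [InnerProductSpace ℂ H] [CompleteSpace H]

/-- The Hilbert space `H ⊕ ⋯ ⊕ H` (`n` summands), with its Hilbert space norm. -/
abbrev Amp (H : Type u) (n : ℕ) : Type u := PiLp 2 (fun _ : Fin n => H)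

/-- The `*`-algebra `M_n(𝓐)` of `n × n` matrices with entries in `𝓐`. -/
abbrev Mat (n : ℕ) (𝓐 : VonNeumannAlgebra H) : Type u :=
  Matrix (Fin n) (Fin n) 𝓐.toStarSubalgebra

/-- `τ` is a faithful normal trace state on `𝓐`. Normality: `τ` preserves least upper bounds of
(bounded) upward directed families of positive elements of `𝓐`. -/
structure IsFaithfulNormalTraceState (𝓐 : VonNeumannAlgebra H)
    (τ : 𝓐.toStarSubalgebra →ₗ[ℂ] ℂ) : Prop where
  map_one : τ 1 = 1
  nonneg : ∀ a, 0 ≤ (τ (star a * a)).re ∧ (τ (star a * a)).im = 0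
  trace : ∀ a b, τ (a * b) = τ (b * a)
  faithful : ∀ a, τ (star a * a) = 0 → a = 0
  normal : ∀ (S : Set 𝓐.toStarSubalgebra) (a : 𝓐.toStarSubalgebra), S.Nonempty →
    (∀ s ∈ S, (0 : H →L[ℂ] H) ≤ (s : H →L[ℂ] H)) →
    DirectedOn (fun s t : 𝓐.toStarSubalgebra => (s : H →L[ℂ] H) ≤ (t : H →L[ℂ] H)) S →
    IsLUB ((fun s : 𝓐.toStarSubalgebra => (s : H →L[ℂ] H)) '' S) (a : H →L[ℂ] H) →
    IsLUB ((fun s : 𝓐.toStarSubalgebra => (τ s).re) '' S) (τ a).re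

/-- The action of `M_n(𝓐)` on `H ⊕ ⋯ ⊕ H` : `(a ξ)_i = ∑_j a_{ij} ξ_j`. -/
def matOp {n : ℕ} {𝓐 : VonNeumannAlgebra H} (a : Mat n 𝓐) : Amp H n →L[ℂ] Amp H n :=
  (PiLp.continuousLinearEquiv 2 ℂ (fun _ : Fin n => H)).symm.toContinuousLinearMap ∘L
    ContinuousLinearMap.pi (fun i => ∑ j, (a i j : H →L[ℂ] H) ∘L PiLp.proj 2 (fun _ => H) j)

@[simp]
theorem matOp_apply {n : ℕ} {𝓐 : VonNeumannAlgebra H} (a : Mat n 𝓐) (ξ : Amp H n) (i : Fin n) :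
    matOp a ξ i = ∑ j, (a i j : H →L[ℂ] H) (ξ j) := by
  simp [matOp]

/-- The embedding `q ↦ q ⊗ 1` of `M_n(ℂ)` into `M_n(𝓐)`. -/
def scalarMat {n : ℕ} (𝓐 : VonNeumannAlgebra H) (q : Matrix (Fin n) (Fin n) ℂ) : Mat n 𝓐 :=
  q.map (algebraMap ℂ 𝓐.toStarSubalgebra)

/-- The conditional expectation `E_n(a) = [τ(a_{ij})]`, where `M_n(ℂ) ⊗ 1` is identified with
`M_n(ℂ)`. -/
def condExpMat {n : ℕ} {𝓐 : VonNeumannAlgebra H} (τ : 𝓐.toStarSubalgebra →ₗ[ℂ] ℂ)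
    (a : Mat n 𝓐) : Matrix (Fin n) (Fin n) ℂ :=
  Matrix.of fun i j => τ (a i j)

/-- The normalized trace `τ_n(a) = (1/n) ∑_j τ(a_{jj})` on `M_n(𝓐)`. -/
def traceMat {n : ℕ} {𝓐 : VonNeumannAlgebra H} (τ : 𝓐.toStarSubalgebra →ₗ[ℂ] ℂ)
    (a : Mat n 𝓐) : ℂ :=
  (1 / (n : ℂ)) * ∑ j, τ (a j j)

/-- `X` is a (possibly unbounded) selfadjoint operator affiliated with `M_n(𝓐)`: it is selfadjoint
and `i - X` is a bijection from its domain onto `H ⊕ ⋯ ⊕ H` whose inverse belongs to `M_n(𝓐)`. -/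
structure IsRandomVariable {n : ℕ} (𝓐 : VonNeumannAlgebra H) (X : Amp H n →ₗ.[ℂ] Amp H n) :
    Prop where
  selfAdjoint : IsSelfAdjoint X
  resolvent_mem : ∃ r : Mat n 𝓐,
    (∀ ξ, ∃ h : matOp r ξ ∈ X.domain, Complex.I • matOp r ξ - X ⟨matOp r ξ, h⟩ = ξ) ∧
    (∀ x : X.domain, matOp r (Complex.I • (x : Amp H n) - X x) = x)

/-- The composition `S X T` of operators, with domain `{ξ | T ξ ∈ dom X}`, where `S`, `T` are
bounded and `X` is possibly unbounded. -/
def sandwich {K : Type u} [NormedAddCommGroup K] [InnerProductSpace ℂ K]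
    (S : K →L[ℂ] K) (X : K →ₗ.[ℂ] K) (T : K →L[ℂ] K) : K →ₗ.[ℂ] K where
  domain := X.domain.comap T.toLinearMap
  toFun := S.toLinearMap ∘ₗ X.toFun ∘ₗ T.toLinearMap.restrict (fun _ h => h)

/-- The composition of operators `(q₁ ⊗ 1) X (q₂ ⊗ 1)`, before taking the closure. -/
def compression {n : ℕ} (𝓐 : VonNeumannAlgebra H) (q₁ : Matrix (Fin n) (Fin n) ℂ)
    (X : Amp H n →ₗ.[ℂ] Amp H n) (q₂ : Matrix (Fin n) (Fin n) ℂ) : Amp H n →ₗ.[ℂ] Amp H n :=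
  sandwich (matOp (scalarMat 𝓐 q₁)) X (matOp (scalarMat 𝓐 q₂))

/-- `Y a = 0`, that is, `a` maps into the domain of `Y` and `Y` vanishes on the range of `a`. -/
def Annihilates {n : ℕ} {𝓐 : VonNeumannAlgebra H} (Y : Amp H n →ₗ.[ℂ] Amp H n)
    (a : Mat n 𝓐) : Prop :=
  ∀ ξ, ∃ h : matOp a ξ ∈ Y.domain, Y ⟨matOp a ξ, h⟩ = 0

/-- `p = ker Y`: the greatest projection `p` in `M_n(𝓐)` such that `Y p = 0`. (For projections,
`r ≤ p` means `p r = r`.) -/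
structure IsKer {n : ℕ} {𝓐 : VonNeumannAlgebra H} (Y : Amp H n →ₗ.[ℂ] Amp H n)
    (p : Mat n 𝓐) : Prop where
  isStarProjection : IsStarProjection p
  annihilates : Annihilates Y p
  greatest : ∀ r : Mat n 𝓐, IsStarProjection r → Annihilates Y r → p * r = r

end TracialVN

end

/-! Subspaces of `Amp H n` invariant under the commutant of `M_n(𝓐)` have a relative dimension, the
unnormalized trace `n τ_n` of the projection onto their closure, with values in `[0, n]`. Polar
decomposition and the trace property give rank-nullity for this dimension.

Start from `q₁ = q₂ = 1`, where the kernel is that of `X`. Suppose `p = ker (q₁ X q₂)` and `E_n(p)`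
is singular. Take the rank one projection `w` onto a vector killed by `E_n(p)`. The trace of `p w`
is that of `E_n(p) w = 0`, so `p w = 0` by faithfulness. Since `1 - q₂ ≤ p`, this forces `w ≤ q₂`,
and passing from `q₂` to `q₂ - w` replaces the kernel by its orthogonal sum with the range of `w`:
the dimension grows by exactly one. The operators `q₁ X q₂` and `q₂ X q₁` are formal adjoints of
each other, so their kernels have equal dimension, and the same step applies on either side. As
dimensions are at most `n`, a pair with the largest integer excess over `dim ker X` exists, and for
it both expectations are invertible.

Unboundedness is handled by measurability: `X` agrees with elements of `M_n(𝓐)` on closed invariant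
subspaces of codimension less than any `ε > 0` (`of_resolvent`). Compressions inherit this. It
yields dense domains, the equality of the kernel dimensions (`dim_kernel_le`), and the fact that
closing an operator only closes its kernel (`exists_isKer_closure`). -/

noncomputable section

open Filter Topology

namespace TracialVN

universe u

/-! ### Invariant subspaces and polar decomposition in a von Neumann algebra -/

section Dimension

variable {K : Type u} [NormedAddCommGroup K] [InnerProductSpace ℂ K] [CompleteSpace K]

/-- The orthogonal projection onto the closure of a subspace. -/
def proj (L : Submodule ℂ K) : K →L[ℂ] K := L.topologicalClosure.starProjection

theorem isStarProjection_proj (L : Submodule ℂ K) : IsStarProjection (proj L) :=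
  isStarProjection_starProjection

theorem proj_apply_of_mem {L : Submodule ℂ K} {x : K} (hx : x ∈ L) : proj L x = x :=
  Submodule.starProjection_eq_self_iff.2 (L.le_topologicalClosure hx)

theorem proj_apply_mem_closure (L : Submodule ℂ K) (x : K) : proj L x ∈ L.topologicalClosure :=
  Submodule.starProjection_apply_mem _ _

theorem proj_apply_mem {L : Submodule ℂ K} (hL : IsClosed (L : Set K)) (x : K) : proj L x ∈ L := by
  simpa [hL.submodule_topologicalClosure_eq] using proj_apply_mem_closure L x

theorem proj_orthogonal (L : Submodule ℂ K) : proj Lᗮ = 1 - proj L := by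
  have h : Lᗮ.topologicalClosure = L.topologicalClosureᗮ := by
    rw [L.isClosed_orthogonal.submodule_topologicalClosure_eq, Submodule.orthogonal_closure]
  simp only [proj, h]
  exact Submodule.starProjection_orthogonal' _

theorem proj_apply_eq_zero_iff {L : Submodule ℂ K} {x : K} : proj L x = 0 ↔ x ∈ Lᗮ := by
  rw [proj, Submodule.starProjection_apply_eq_zero_iff, Submodule.orthogonal_closure]

theorem eq_proj_of_range {p : K →L[ℂ] K} (hp : IsStarProjection p) {L : Submodule ℂ K}
    (h₁ : ∀ x ∈ L, p x = x) (h₂ : ∀ x, p x ∈ L.topologicalClosure) : p = proj L := by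
  have hL : ∀ x ∈ L.topologicalClosure, p x = x := fun x hx =>
    closure_minimal (s := (L : Set K)) (t := {x | p x = x}) h₁
      (isClosed_eq p.continuous continuous_id) hx
  ext x
  refine (Submodule.eq_starProjection_of_mem_of_inner_eq_zero (h₂ x) fun w hw => ?_).symm
  have hs : ∀ a b, inner ℂ (p a) b = inner ℂ a (p b) := fun a b => by
    conv_rhs => rw [← ContinuousLinearMap.adjoint_inner_left,
      ← ContinuousLinearMap.star_eq_adjoint, hp.isSelfAdjoint.star_eq]
  rw [inner_sub_left, hs, hL w hw, sub_self]

theorem proj_range_of_isStarProjection {p : K →L[ℂ] K} (hp : IsStarProjection p) :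
    proj (LinearMap.range p.toLinearMap) = p := by
  refine (eq_proj_of_range hp ?_ fun x => Submodule.le_topologicalClosure _
    (LinearMap.mem_range_self p.toLinearMap x)).symm
  rintro _ ⟨x, rfl⟩
  exact congrArg (fun T : K →L[ℂ] K => T x) hp.isIdempotentElem.eq

theorem proj_top : proj (⊤ : Submodule ℂ K) = 1 := by
  ext x
  simpa using proj_apply_of_mem (Submodule.mem_top (x := x))

theorem proj_mul_proj_of_le {L L' : Submodule ℂ K} (h : L ≤ L'.topologicalClosure) :
    proj L' * proj L = proj L := by
  ext x
  exact Submodule.starProjection_eq_self_iff.2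
    (Submodule.topologicalClosure_minimal _ h L'.isClosed_topologicalClosure
      (proj_apply_mem_closure L x))

theorem proj_sup_of_le_orthogonal {L L' : Submodule ℂ K} (h : L' ≤ Lᗮ) :
    proj (L ⊔ L') = proj L + proj L' := by
  have h' : L ≤ L'ᗮ := L.le_orthogonal_orthogonal.trans (Submodule.orthogonal_le h)
  have h0 : proj L * proj L' = 0 := by
    ext x
    refine proj_apply_eq_zero_iff.2 ?_
    exact Submodule.topologicalClosure_minimal _ h L.isClosed_orthogonal
      (proj_apply_mem_closure L' x)
  symm
  refine eq_proj_of_range ((isStarProjection_proj L).add (isStarProjection_proj L') h0) ?_ ?_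
  · intro x hx
    obtain ⟨a, ha, b, hb, rfl⟩ := Submodule.mem_sup.1 hx
    simp [proj_apply_of_mem ha, proj_apply_of_mem hb, proj_apply_eq_zero_iff.2 (h hb),
      proj_apply_eq_zero_iff.2 (h' ha)]
  · intro x
    exact add_mem (Submodule.topologicalClosure_mono le_sup_left (proj_apply_mem_closure L x))
      (Submodule.topologicalClosure_mono le_sup_right (proj_apply_mem_closure L' x))

/-- `L` is invariant under the commutant of `M`. -/
def IsInvariant (M : VonNeumannAlgebra K) (L : Submodule ℂ K) : Prop :=
  ∀ T ∈ M.commutant, ∀ x ∈ L, T x ∈ L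

variable {M : VonNeumannAlgebra K} {L L' : Submodule ℂ K}

theorem apply_comm_of_mem_commutant {a T : K →L[ℂ] K} (ha : a ∈ M) (hT : T ∈ M.commutant)
    (x : K) : a (T x) = T (a x) :=
  congrArg (fun S : K →L[ℂ] K => S x) (VonNeumannAlgebra.mem_commutant_iff.1 hT a ha)

theorem mem_of_commute {a : K →L[ℂ] K} (h : ∀ T ∈ M.commutant, ∀ x, a (T x) = T (a x)) :
    a ∈ M := by
  rw [← M.commutant_commutant, VonNeumannAlgebra.mem_commutant_iff]
  intro T hT
  ext x
  exact (h T hT x).symm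

namespace IsInvariant

theorem closure (h : IsInvariant M L) : IsInvariant M L.topologicalClosure := fun T hT =>
  fun _ hx => map_mem_closure T.continuous hx (h T hT)

theorem inf (h : IsInvariant M L) (h' : IsInvariant M L') : IsInvariant M (L ⊓ L') :=
  fun T hT x hx => ⟨h T hT x hx.1, h' T hT x hx.2⟩

theorem comap (h : IsInvariant M L) {a : K →L[ℂ] K} (ha : a ∈ M) :
    IsInvariant M (L.comap a.toLinearMap) := by
  intro T hT x hx
  have := h T hT _ hx
  simpa [apply_comm_of_mem_commutant ha hT] using this

theorem orthogonal (h : IsInvariant M L) : IsInvariant M Lᗮ := by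
  intro T hT x hx
  rw [Submodule.mem_orthogonal] at hx ⊢
  intro y hy
  rw [← ContinuousLinearMap.adjoint_inner_left]
  exact hx _ (h _ (star_mem hT) y hy)

theorem proj_mem (h : IsInvariant M L) : proj L ∈ M := by
  refine (VonNeumannAlgebra.IsStarProjection.mem_iff (isStarProjection_proj L) M).2
    fun T hT => ?_
  intro x hx
  rw [proj, Submodule.range_starProjection] at *
  exact h.closure T hT x hx

end IsInvariant

theorem isInvariant_ker {a : K →L[ℂ] K} (ha : a ∈ M) :
    IsInvariant M (LinearMap.ker a.toLinearMap) := by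
  intro T hT x hx
  have hx' : a x = 0 := hx
  simp [apply_comm_of_mem_commutant ha hT, hx']

theorem isInvariant_range {a : K →L[ℂ] K} (ha : a ∈ M) :
    IsInvariant M (LinearMap.range a.toLinearMap) := by
  rintro T hT _ ⟨x, rfl⟩
  exact ⟨T x, apply_comm_of_mem_commutant ha hT x⟩

theorem isInvariant_top : IsInvariant M (⊤ : Submodule ℂ K) := fun _ _ _ _ => trivial

/-- Polar decomposition, in a von Neumann algebra. -/
theorem exists_polar {a : K →L[ℂ] K} (ha : a ∈ M) :
    ∃ v ∈ M, star v * v = 1 - proj (LinearMap.ker a.toLinearMap) ∧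
      v * star v = proj (LinearMap.range a.toLinearMap) := by
  set b : K →L[ℂ] K := CFC.abs a with hb
  have hbs : star b = b := (CFC.abs_nonneg a).isSelfAdjoint.star_eq
  have hbb : star b * b = star a * a := by rw [hbs]; exact CFC.abs_mul_abs a
  have hinner : ∀ (c : K →L[ℂ] K) x y, inner ℂ (c x) (c y) = inner ℂ ((star c * c) x) y := by
    intro c x y
    simp [ContinuousLinearMap.star_eq_adjoint, ContinuousLinearMap.adjoint_inner_left]
  have hnorm : ∀ x, ‖a x‖ = ‖b x‖ := by
    intro x
    rw [@norm_eq_sqrt_re_inner ℂ, @norm_eq_sqrt_re_inner ℂ, hinner a, hinner b, hbb]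
  set L := LinearMap.range b.toLinearMap
  set C := L.topologicalClosure
  let e : K →ₗ[ℂ] C := b.toLinearMap.codRestrict C fun x => L.le_topologicalClosure ⟨x, rfl⟩
  have he : DenseRange e := by
    intro x
    rw [Topology.IsInducing.subtypeVal.closure_eq_preimage_closure_image]
    have hx : (x : K) ∈ _root_.closure (L : Set K) := x.2
    refine _root_.closure_mono ?_ hx
    rintro _ ⟨z, rfl⟩
    exact ⟨e z, ⟨z, rfl⟩, rfl⟩
  have hbd : ∃ c : ℝ, ∀ x, ‖a.toLinearMap x‖ ≤ c * ‖e x‖ := ⟨1, fun x => by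
    rw [one_mul]; exact (hnorm x).le⟩
  -- Since `‖a x‖ = ‖b x‖`, the map `b x ↦ a x` is well defined and isometric; `w` extends it to the
  -- closure of the range of `b`, and `v` is `w` extended by zero on the complement.
  let w : C →L[ℂ] K := a.toLinearMap.extendOfNorm e
  have hw : ∀ x, w (e x) = a x := fun x => LinearMap.extendOfNorm_eq he hbd x
  let v : K →L[ℂ] K := w ∘L C.orthogonalProjectionOnto
  have hvb : ∀ x, v (b x) = a x := by
    intro x
    rw [← hw x]
    exact congrArg w (C.orthogonalProjectionOnto_mem_subspace_eq_self (e x))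
  have hwn : ∀ c, ‖w c‖ = ‖c‖ := fun c =>
    he.induction_on (p := fun c => ‖w c‖ = ‖c‖) c
      (isClosed_eq (by fun_prop) (by fun_prop)) fun x => by rw [hw x]; exact hnorm x
  have hwi : ∀ c c', inner ℂ (w c) (w c') = inner ℂ c c' :=
    (LinearMap.norm_map_iff_inner_map_map w).1 hwn
  have hvv : star v * v = proj L := by
    ext x
    refine ext_inner_right ℂ fun y => ?_
    rw [← hinner, show v x = w (C.orthogonalProjectionOnto x) from rfl,
      show v y = w (C.orthogonalProjectionOnto y) from rfl, hwi, Submodule.coe_inner]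
    change inner ℂ (proj L x) (proj L y) = _
    have hi := hinner (proj L) x y
    rwa [(isStarProjection_proj L).isSelfAdjoint.star_eq,
      (isStarProjection_proj L).isIdempotentElem.eq] at hi
  have hvL : ∀ x ∈ Lᗮ, v x = 0 := by
    intro x hx
    have h0 : ‖v x‖ = 0 := by
      rw [show v x = w (C.orthogonalProjectionOnto x) from rfl, hwn]
      have := proj_apply_eq_zero_iff.2 hx
      rw [proj, Submodule.starProjection_apply] at this
      rw [Submodule.coe_norm, this, norm_zero]
    exact norm_eq_zero.1 h0
  have hvp : v * proj L = v := by
    ext x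
    change w (C.orthogonalProjectionOnto (C.orthogonalProjectionOnto x)) = _
    rw [C.orthogonalProjectionOnto_mem_subspace_eq_self]
    rfl
  have hbM : b ∈ M := by
    refine mem_of_commute fun T hT x => ?_
    have h1 : Commute a T := VonNeumannAlgebra.mem_commutant_iff.1 hT a ha
    have h2 : Commute a (star T) :=
      VonNeumannAlgebra.mem_commutant_iff.1 (star_mem hT) a ha
    exact congrArg (fun S : K →L[ℂ] K => S x) (h1.cfcAbs_left h2).eq
  have hker : LinearMap.ker a.toLinearMap = Lᗮ := by
    ext x
    rw [LinearMap.mem_ker, ← norm_eq_zero]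
    change ‖a x‖ = 0 ↔ _
    rw [hnorm, norm_eq_zero, Submodule.mem_orthogonal]
    have hadj : ∀ y, inner ℂ (b y) x = inner ℂ y (b x) := fun y => by
      rw [← ContinuousLinearMap.adjoint_inner_right, ← ContinuousLinearMap.star_eq_adjoint, hbs]
    constructor
    · rintro h _ ⟨y, rfl⟩
      exact (hadj y).trans (by rw [h, inner_zero_right])
    · intro h
      rw [← @inner_self_eq_zero ℂ, ← hadj]
      exact h _ ⟨_, rfl⟩
  refine ⟨v, ?_, ?_, ?_⟩
  -- By the bicommutant theorem it is enough to commute with the commutant, separately on the closed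
  -- range of `b` and on its complement, both of which are invariant.
  · refine mem_of_commute fun T hT x => ?_
    have hL := isInvariant_range hbM
    have hC : ∀ c ∈ C, v (T c) = T (v c) := fun c hc =>
      closure_minimal (s := (L : Set K)) (t := {c | v (T c) = T (v c)})
        (by
          rintro _ ⟨y, rfl⟩
          change v (T (b y)) = T (v (b y))
          rw [← apply_comm_of_mem_commutant hbM hT, hvb, hvb, apply_comm_of_mem_commutant ha hT])
        (isClosed_eq (by fun_prop) (by fun_prop)) hc
    have hx : x = proj L x + (x - proj L x) := by abel
    have hx' : x - proj L x ∈ Lᗮ := by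
      rw [← Submodule.orthogonal_closure]
      exact Submodule.sub_starProjection_mem_orthogonal x
    rw [hx, map_add, map_add, map_add, map_add, hC _ (proj_apply_mem_closure L x),
      hvL _ hx', hvL _ (hL.orthogonal T hT _ hx'), map_zero]
  · rw [hvv, hker, proj_orthogonal, sub_sub_cancel]
  · have hidem : IsIdempotentElem (v * star v) := by
      change v * star v * (v * star v) = _
      rw [mul_assoc, ← mul_assoc (star v), hvv, ← mul_assoc, hvp]
    refine eq_proj_of_range ⟨hidem, .mul_star_self v⟩ ?_ fun x => ?_
    · rintro _ ⟨x, rfl⟩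
      change (v * star v) (a x) = a x
      rw [← hvb x]
      change (v * star v * v) (b x) = v (b x)
      rw [mul_assoc, hvv, hvp]
    · change w _ ∈ _
      refine he.induction_on (p := fun c => w c ∈ (LinearMap.range a.toLinearMap).topologicalClosure)
        _ ((Submodule.isClosed_topologicalClosure _).preimage w.continuous) fun y => ?_
      rw [hw y]
      exact Submodule.le_topologicalClosure _ (LinearMap.mem_range_self a.toLinearMap y)

end Dimension

/-! ### Truncations by continuous functional calculus -/

section FunctionalCalculus

variable {A : Type*} [CStarAlgebra A] {s : A} {c : ℝ}

/-- On the kernel of `(c - s)₊`, which plays the part of the spectral subspace `s ≥ c`, the last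
term vanishes and `max(s, c)⁻¹` inverts `s`. -/
theorem mul_cfc_inv_max (hs : IsSelfAdjoint s) (hc : 0 < c) :
    s * cfc (fun t : ℝ => (max t c)⁻¹) s = 1 - c⁻¹ • cfc (fun t : ℝ => max (c - t) 0) s := by
  have hcont : Continuous fun t => (max t c)⁻¹ :=
    (continuous_id.max continuous_const).inv₀ fun t => (hc.trans_le (le_max_right _ _)).ne'
  have hcont' : Continuous fun t => max (c - t) 0 := by fun_prop
  nth_rewrite 1 [← cfc_id' ℝ s]
  rw [← cfc_mul (fun t => t) (fun t => (max t c)⁻¹) s continuousOn_id hcont.continuousOn,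
    ← cfc_const_one ℝ s, ← cfc_smul c⁻¹ (fun t => max (c - t) 0) s hcont'.continuousOn,
    ← cfc_sub (fun _ => (1 : ℝ)) (fun t => c⁻¹ • max (c - t) 0) s continuousOn_const
      (hcont'.const_smul c⁻¹).continuousOn]
  congr 1
  ext t
  rcases le_total c t with h | h
  · rw [max_eq_left h, max_eq_right (sub_nonpos.2 h), smul_zero, sub_zero,
      mul_inv_cancel₀ (hc.trans_le h).ne']
  · rw [max_eq_right h, max_eq_left (sub_nonneg.2 h), smul_eq_mul]
    field_simp
    ring

/-- The two functions have disjoint supports. Hence the range of `(s - c)₊` lies in the kernel of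
`(c - s)₊`. -/
theorem cfc_truncation_mul (_hs : IsSelfAdjoint s) :
    cfc (fun t : ℝ => max (c - t) 0) s * cfc (fun t : ℝ => max (t - c) 0) s = 0 := by
  have h1 : Continuous fun t : ℝ => max (c - t) 0 := by fun_prop
  have h2 : Continuous fun t : ℝ => max (t - c) 0 := by fun_prop
  rw [← cfc_mul _ _ s h1.continuousOn h2.continuousOn]
  have : (fun t => max (c - t) 0 * max (t - c) 0) = fun _ => 0 := by
    ext t
    rcases le_total c t with h | h
    · rw [max_eq_right (sub_nonpos.2 h), zero_mul]
    · rw [max_eq_right (sub_nonpos.2 h), mul_zero]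
  rw [this, cfc_const_zero]

theorem norm_cfc_truncation_sub_le [PartialOrder A] [StarOrderedRing A] (hs : 0 ≤ s)
    (hc : 0 ≤ c) : ‖cfc (fun t : ℝ => max (t - c) 0) s - s‖ ≤ c := by
  have h1 : Continuous fun t : ℝ => max (t - c) 0 := by fun_prop
  have heq : cfc (fun t : ℝ => max (t - c) 0) s - s =
      cfc (fun t : ℝ => max (t - c) 0 - t) s := by
    rw [cfc_sub (fun t : ℝ => max (t - c) 0) (fun t => t) s h1.continuousOn continuousOn_id,
      cfc_id' ℝ s]
  rw [heq]
  refine norm_cfc_le hc fun t ht => ?_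
  have ht0 : 0 ≤ t := spectrum_nonneg_of_nonneg hs ht
  rw [Real.norm_eq_abs, abs_le]
  constructor <;> rcases max_cases (t - c) 0 with h | h <;> linarith

end FunctionalCalculus

/-! ### Relative dimension defined by a faithful normal trace -/

section Trace

variable {K : Type u} [NormedAddCommGroup K] [InnerProductSpace ℂ K] [CompleteSpace K]

/-- If `b x = 0`, then `⟨a x, x⟩ ≤ 0`, so the square root of `a` kills `x`. -/
theorem ker_le_ker_of_le {a b : K →L[ℂ] K} (ha : 0 ≤ a) (hab : a ≤ b) :
    LinearMap.ker b.toLinearMap ≤ LinearMap.ker a.toLinearMap := by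
  intro x hx
  have hx' : b x = 0 := hx
  have h1 : (inner ℂ (a x) x).re ≤ 0 := by
    have h : 0 ≤ (inner ℂ (b x - a x) x).re :=
      ((ContinuousLinearMap.le_def _ _).1 hab).re_inner_nonneg_left x
    rw [hx', zero_sub, inner_neg_left, Complex.neg_re] at h
    linarith
  set C := CFC.sqrt a
  have hC : C * C = a := CFC.sqrt_mul_sqrt_self a
  have hCs : star C = C := (CFC.sqrt_nonneg _).isSelfAdjoint.star_eq
  have h2 : inner ℂ (C x) (C x) = inner ℂ (a x) x := by
    rw [← hC, ← ContinuousLinearMap.adjoint_inner_left, ← ContinuousLinearMap.star_eq_adjoint,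
      hCs]
    rfl
  have h3 : C x = 0 := by
    rw [← h2] at h1
    exact (re_inner_self_nonpos (𝕜 := ℂ)).1 h1
  change a x = 0
  rw [← hC]
  change C (C x) = 0
  rw [h3, map_zero]

/-- `d` is the (real part of the) restriction of a faithful normal trace to `M`. Normality is
only required for increasing sequences of projections. -/
structure IsDimTrace (M : VonNeumannAlgebra K) (d : (K →L[ℂ] K) → ℝ) : Prop where
  map_add : ∀ a ∈ M, ∀ b ∈ M, d (a + b) = d a + d b
  nonneg : ∀ a ∈ M, 0 ≤ d (star a * a)
  comm : ∀ a ∈ M, ∀ b ∈ M, d (a * b) = d (b * a)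
  faithful : ∀ a ∈ M, d (star a * a) = 0 → a = 0
  normal : ∀ F : ℕ → Submodule ℂ K, Monotone F → (∀ k, IsInvariant M (F k)) →
    (⨆ k, F k).topologicalClosure = ⊤ → ∀ ε > 0, ∃ k, d 1 - ε < d (proj (F k))

/-- The relative dimension of a subspace. -/
def dim (d : (K →L[ℂ] K) → ℝ) (L : Submodule ℂ K) : ℝ := d (proj L)

theorem dim_top (d : (K →L[ℂ] K) → ℝ) : dim d ⊤ = d 1 := by rw [dim, proj_top]

namespace IsDimTrace

variable {M : VonNeumannAlgebra K} {d : (K →L[ℂ] K) → ℝ} {L L' : Submodule ℂ K}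

theorem map_sub (hd : IsDimTrace M d) {a b : K →L[ℂ] K} (ha : a ∈ M) (hb : b ∈ M) : d
    (a - b) = d a - d b := by
  have := hd.map_add (a - b) (sub_mem ha hb) b hb
  rw [sub_add_cancel] at this
  linarith

theorem nonneg_of_isStarProjection (hd : IsDimTrace M d) {p : K →L[ℂ] K} (hp : IsStarProjection p)
    (h : p ∈ M) :
    0 ≤ d p := by
  have := hd.nonneg p h
  rwa [hp.isSelfAdjoint.star_eq, hp.isIdempotentElem.eq] at this

theorem dim_nonneg (hd : IsDimTrace M d) (h : IsInvariant M L) : 0 ≤ dim d L :=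
  hd.nonneg_of_isStarProjection (isStarProjection_proj L) h.proj_mem

theorem dim_orthogonal (hd : IsDimTrace M d) (h : IsInvariant M L) : dim d Lᗮ = d 1 - dim d L := by
  rw [dim, proj_orthogonal, hd.map_sub (one_mem M) h.proj_mem, dim]

theorem isStarProjection_sub_of_le (h : L ≤ L'.topologicalClosure) :
    IsStarProjection (proj L' - proj L) :=
  (isStarProjection_proj L).sub_of_mul_eq_right (isStarProjection_proj L')
    (proj_mul_proj_of_le h)

theorem dim_mono_closure (hd : IsDimTrace M d) (h : IsInvariant M L) (h' : IsInvariant M L')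
    (hle : L ≤ L'.topologicalClosure) : dim d L ≤ dim d L' := by
  have := hd.nonneg_of_isStarProjection (isStarProjection_sub_of_le hle)
    (sub_mem h'.proj_mem h.proj_mem)
  rw [hd.map_sub h'.proj_mem h.proj_mem] at this
  exact sub_nonneg.1 this

theorem dim_mono (hd : IsDimTrace M d) (h : IsInvariant M L) (h' : IsInvariant M L')
    (hle : L ≤ L') :
    dim d L ≤ dim d L' :=
  hd.dim_mono_closure h h' (hle.trans L'.le_topologicalClosure)

theorem dim_le (hd : IsDimTrace M d) (h : IsInvariant M L) : dim d L ≤ d 1 :=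
  (hd.dim_mono h isInvariant_top le_top).trans_eq (dim_top d)

theorem le_closure_of_dim_le (hd : IsDimTrace M d) (h : IsInvariant M L) (h' : IsInvariant M L')
    (hle : L ≤ L'.topologicalClosure) (hdim : dim d L' ≤ dim d L) :
    L' ≤ L.topologicalClosure := by
  have hp := isStarProjection_sub_of_le hle
  have h0 : proj L' - proj L = 0 := by
    refine hd.faithful _ (sub_mem h'.proj_mem h.proj_mem) ?_
    rw [hp.isSelfAdjoint.star_eq, hp.isIdempotentElem.eq, hd.map_sub h'.proj_mem h.proj_mem]
    have := hd.dim_mono_closure h h' hle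
    unfold dim at *
    linarith
  intro x hx
  have := proj_apply_mem_closure L x
  rwa [← sub_eq_zero.1 h0, proj_apply_of_mem hx] at this

theorem dim_sup (hd : IsDimTrace M d) (h : IsInvariant M L) (h' : IsInvariant M L') (ho : L' ≤ Lᗮ) :
    dim d (L ⊔ L') = dim d L + dim d L' := by
  rw [dim, proj_sup_of_le_orthogonal ho, hd.map_add _ h.proj_mem _ h'.proj_mem, dim, dim]

/-- Rank-nullity: the polar part `v` makes the complement of the kernel projection and the range
projection equivalent, and the trace does not distinguish `star v * v` from `v * star v`. -/
theorem dim_ker_add_dim_range (hd : IsDimTrace M d) {a : K →L[ℂ] K} (ha : a ∈ M) :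
    dim d (LinearMap.ker a.toLinearMap) + dim d (LinearMap.range a.toLinearMap) = d 1 := by
  obtain ⟨v, hv, h1, h2⟩ := exists_polar ha
  rw [dim, dim, ← h2, hd.comm v hv _ (star_mem hv), h1,
    hd.map_sub (one_mem M) (isInvariant_ker ha).proj_mem]
  ring

theorem dim_ker_mul_proj (hd : IsDimTrace M d) {F : Submodule ℂ K} (hF : IsInvariant M F)
    (hc : IsClosed (F : Set K))
    {a : K →L[ℂ] K} (ha : a ∈ M) :
    dim d (LinearMap.ker (a * proj F).toLinearMap) =
      d 1 - dim d F + dim d (F ⊓ LinearMap.ker a.toLinearMap) := by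
  have hker : LinearMap.ker (a * proj F).toLinearMap = Fᗮ ⊔ F ⊓ LinearMap.ker a.toLinearMap := by
    apply le_antisymm
    · intro x hx
      have hx' : a (proj F x) = 0 := hx
      refine Submodule.mem_sup.2 ⟨x - proj F x, ?_, proj F x, ⟨proj_apply_mem hc x, hx'⟩, by abel⟩
      rw [← Submodule.orthogonal_closure]
      exact Submodule.sub_starProjection_mem_orthogonal x
    · refine sup_le (fun x hx => ?_) fun x hx => ?_
      · change a (proj F x) = 0
        rw [proj_apply_eq_zero_iff.2 hx, map_zero]
      · change a (proj F x) = 0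
        rw [proj_apply_of_mem hx.1]
        exact hx.2
  rw [hker, hd.dim_sup hF.orthogonal (hF.inf (isInvariant_ker ha))
    (inf_le_left.trans F.le_orthogonal_orthogonal), hd.dim_orthogonal hF]

/-- Rank-nullity for `proj Fᗮ * proj L`: its kernel is the orthogonal sum of `Lᗮ` and `L ⊓ F`, and
its range lies in `Fᗮ`. -/
theorem le_dim_inf (hd : IsDimTrace M d) {F : Submodule ℂ K} (h : IsInvariant M L) (hc : IsClosed
    (L : Set K))
    (hF : IsInvariant M F) (hFc : IsClosed (F : Set K)) :
    dim d L + dim d F - d 1 ≤ dim d (L ⊓ F) := by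
  have h1 := hd.dim_ker_add_dim_range (mul_mem hF.orthogonal.proj_mem h.proj_mem)
  rw [hd.dim_ker_mul_proj h hc hF.orthogonal.proj_mem] at h1
  have h2 : LinearMap.ker (proj Fᗮ).toLinearMap = F := by
    ext x
    change proj Fᗮ x = 0 ↔ _
    rw [proj_apply_eq_zero_iff, Submodule.orthogonal_orthogonal_eq_closure,
      hFc.submodule_topologicalClosure_eq]
  rw [h2] at h1
  have h3 : dim d (LinearMap.range (proj Fᗮ * proj L).toLinearMap) ≤ dim d Fᗮ := by
    refine hd.dim_mono (isInvariant_range (mul_mem hF.orthogonal.proj_mem h.proj_mem))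
      hF.orthogonal ?_
    rintro _ ⟨x, rfl⟩
    exact proj_apply_mem F.isClosed_orthogonal _
  rw [hd.dim_orthogonal hF] at h3
  linarith

theorem le_dim_comap (hd : IsDimTrace M d) {F : Submodule ℂ K} (hF : IsInvariant M F)
    (hFc : IsClosed (F : Set K))
    {a : K →L[ℂ] K} (ha : a ∈ M) : dim d F ≤ dim d (F.comap a.toLinearMap) := by
  have h0 := mul_mem hF.orthogonal.proj_mem ha
  have h1 := hd.dim_ker_add_dim_range h0
  have h2 : LinearMap.ker (proj Fᗮ * a).toLinearMap = F.comap a.toLinearMap := by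
    ext x
    change proj Fᗮ (a x) = 0 ↔ a x ∈ F
    rw [proj_apply_eq_zero_iff, Submodule.orthogonal_orthogonal_eq_closure,
      hFc.submodule_topologicalClosure_eq]
  have h3 : dim d (LinearMap.range (proj Fᗮ * a).toLinearMap) ≤ dim d Fᗮ := by
    refine hd.dim_mono (isInvariant_range h0) hF.orthogonal ?_
    rintro _ ⟨x, rfl⟩
    exact proj_apply_mem F.isClosed_orthogonal _
  rw [hd.dim_orthogonal hF] at h3
  rw [h2] at h1
  linarith

/-- Cutting `P` by `F` costs less than `ε` in dimension, so `P ⊓ N` has the full dimension of `P`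
and is dense in it by faithfulness. This turns agreement on large subspaces into density. -/
theorem le_closure_of_forall (hd : IsDimTrace M d) {P N : Submodule ℂ K} (hP : IsInvariant M P)
    (hPc : IsClosed (P : Set K)) (hN : IsInvariant M N)
    (h : ∀ ε > 0, ∃ F, IsInvariant M F ∧ IsClosed (F : Set K) ∧ d 1 - ε < dim d F ∧ P ⊓ F ≤ N) :
    P ≤ N.topologicalClosure := by
  have h1 : P ≤ (P ⊓ N).topologicalClosure := by
    refine hd.le_closure_of_dim_le (hP.inf hN) hP (inf_le_left.trans P.le_topologicalClosure) ?_
    refine le_of_forall_pos_le_add fun ε hε => ?_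
    obtain ⟨F, hF, hFc, hdF, hle⟩ := h ε hε
    have h2 := hd.le_dim_inf hP hPc hF hFc
    have h3 := hd.dim_mono (hP.inf hF) (hP.inf hN) (le_inf inf_le_left hle)
    linarith
  exact h1.trans (Submodule.topologicalClosure_mono inf_le_right)

/-- The range of an element of `M` with dense range contains large closed subspaces, on which the
element has a right inverse in `M`. -/
theorem exists_rightInverse_of_dense (hd : IsDimTrace M d) {r : K →L[ℂ] K} (hr : r ∈ M)
    (hdr : DenseRange r) (ε : ℝ)
    (hε : 0 < ε) : ∃ F, IsInvariant M F ∧ IsClosed (F : Set K) ∧ d 1 - ε < dim d F ∧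
      ∃ b ∈ M, ∀ x ∈ F, r (b x) = x := by
  set s : K →L[ℂ] K := r * star r with hs
  have hs0 : 0 ≤ s := mul_star_self_nonneg r
  have hsa : IsSelfAdjoint s := .mul_star_self r
  have hsM : s ∈ M := mul_mem hr (star_mem hr)
  have hM : ∀ f : ℝ → ℝ, cfc f s ∈ M := by
    intro f
    refine mem_of_commute fun T hT x => ?_
    have h1 : Commute s T := VonNeumannAlgebra.mem_commutant_iff.1 hT s hsM
    exact congrArg (fun S : K →L[ℂ] K => S x) (h1.cfc_real f).eq
  let c : ℕ → ℝ := fun k => ((k : ℝ) + 1)⁻¹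
  have hc : ∀ k, 0 < c k := fun k => by positivity
  let g : ℕ → ℝ → ℝ := fun k t => max (c k - t) 0
  -- `F k` stands for the spectral subspace of `s` on `[c k, ∞)`; it increases with `k` because `c
  -- k` decreases.
  let F : ℕ → Submodule ℂ K := fun k => LinearMap.ker (cfc (g k) s).toLinearMap
  have hFc : ∀ k, IsClosed (F k : Set K) := fun k => (cfc (g k) s).isClosed_ker
  have hF : ∀ k, IsInvariant M (F k) := fun k => isInvariant_ker (hM _)
  have hmono : Monotone F := by
    intro j k hjk x hx
    have hck : c k ≤ c j := by
      have : (j : ℝ) ≤ k := Nat.cast_le.2 hjk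
      exact inv_anti₀ (by positivity) (by linarith)
    have hle : cfc (g k) s ≤ cfc (g j) s :=
      cfc_mono fun t _ => max_le_max (sub_le_sub_right hck t) le_rfl
    have hA : 0 ≤ cfc (g k) s := cfc_nonneg fun t _ => le_max_right _ _
    exact ker_le_ker_of_le hA hle hx
  have hdense : (⨆ k, F k).topologicalClosure = ⊤ := by
    rw [Submodule.topologicalClosure_eq_top_iff, Submodule.eq_bot_iff]
    intro y hy
    -- The vectors `(s - c k)₊ y` lie in `F k` and converge to `s y`. If `y` is orthogonal to all `F
    -- k`, then `⟨s y, y⟩ = 0`, so `star r y = 0` and `y` is orthogonal to the dense range of `r`.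
    have hmem : s y ∈ (⨆ k, F k).topologicalClosure := by
      have hlim : Tendsto (fun k => cfc (fun t : ℝ => max (t - c k) 0) s y) atTop (𝓝 (s y)) := by
        rw [tendsto_iff_norm_sub_tendsto_zero]
        have hc0 : Tendsto (fun k => c k * ‖y‖) atTop (𝓝 0) := by
          have := (tendsto_inv_atTop_zero.comp
            (tendsto_atTop_add_const_right _ (1 : ℝ) tendsto_natCast_atTop_atTop)).mul_const ‖y‖
          simpa [c, Function.comp_def] using this
        refine squeeze_zero (fun _ => norm_nonneg _) (fun k => ?_) hc0
        have hn := norm_cfc_truncation_sub_le hs0 (hc k).le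
        exact (ContinuousLinearMap.le_opNorm (cfc (fun t : ℝ => max (t - c k) 0) s - s) y).trans
          (mul_le_mul_of_nonneg_right hn (norm_nonneg y))
      refine mem_closure_of_tendsto hlim (Eventually.of_forall fun k => ?_)
      refine Submodule.mem_iSup_of_mem k ?_
      change (cfc (g k) s * cfc (fun t : ℝ => max (t - c k) 0) s) y = 0
      rw [cfc_truncation_mul hsa]
      rfl
    have h1 : inner ℂ (s y) y = 0 := by
      rw [← Submodule.orthogonal_closure] at hy
      exact hy _ hmem
    have h2 : star r y = 0 := by
      rw [← @inner_self_eq_zero ℂ, ← h1, ContinuousLinearMap.star_eq_adjoint,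
        ContinuousLinearMap.adjoint_inner_right]
      rfl
    refine hdr.eq_zero_of_inner_left (𝕜 := ℂ) fun x => ?_
    rw [← ContinuousLinearMap.adjoint_inner_left, ← ContinuousLinearMap.star_eq_adjoint, h2,
      inner_zero_left]
  obtain ⟨k, hk⟩ := hd.normal F hmono hF hdense ε hε
  refine ⟨F k, hF k, hFc k, hk, star r * cfc (fun t => (max t (c k))⁻¹) s,
    mul_mem (star_mem hr) (hM _), fun x hx => ?_⟩
  have hx' : cfc (g k) s x = 0 := hx
  have key := mul_cfc_inv_max hsa (hc k)
  change (r * (star r * cfc (fun t => (max t (c k))⁻¹) s)) x = x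
  rw [← mul_assoc, ← hs, key]
  change x - (c k)⁻¹ • cfc (g k) s x = x
  rw [hx', smul_zero, sub_zero]

end IsDimTrace

end Trace

/-! ### Measurable operators and the dimension of their kernels -/

section Unbounded

variable {K : Type u} [NormedAddCommGroup K] [InnerProductSpace ℂ K]
  {Y Y' Z : K →ₗ.[ℂ] K}

/-- The kernel of a partially defined operator, as a subspace. -/
def kernel (Y : K →ₗ.[ℂ] K) : Submodule ℂ K := (LinearMap.ker Y.toFun).map Y.domain.subtype

theorem mem_kernel {x : K} : x ∈ kernel Y ↔ ∃ h : x ∈ Y.domain, Y ⟨x, h⟩ = 0 := by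
  constructor
  · rintro ⟨x, hx, rfl⟩
    exact ⟨x.2, hx⟩
  · rintro ⟨h, hx⟩
    exact ⟨⟨x, h⟩, hx, rfl⟩

/-- The closure of an operator vanishes on the closure of its kernel. -/
theorem closure_kernel_le (hY : Y.IsClosable) :
    (kernel Y).topologicalClosure ≤ kernel Y.closure := by
  intro x hx
  have hg : (x, (0 : K)) ∈ Y.graph.topologicalClosure := by
    have hf : Continuous fun x : K => (x, (0 : K)) := by fun_prop
    refine map_mem_closure (f := fun x : K => (x, (0 : K))) hf hx fun z hz => ?_
    obtain ⟨h, hz⟩ := mem_kernel.1 hz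
    exact (LinearPMap.mem_graph_iff _).2 ⟨⟨z, h⟩, rfl, hz⟩
  rw [hY.graph_closure_eq_closure_graph, LinearPMap.mem_graph_iff] at hg
  obtain ⟨y, hy, hy0⟩ := hg
  subst hy
  exact mem_kernel.2 ⟨y.2, hy0⟩

theorem isClosed_kernel (hY : Y.IsClosed) : IsClosed (kernel Y : Set (K)) := by
  have hf : Continuous fun x : K => (x, (0 : K)) := by fun_prop
  convert IsClosed.preimage hf hY
  ext x
  rw [SetLike.mem_coe, mem_kernel, Set.mem_preimage, SetLike.mem_coe, LinearPMap.mem_graph_iff]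
  constructor
  · rintro ⟨h, hx⟩
    exact ⟨⟨x, h⟩, rfl, hx⟩
  · rintro ⟨y, hy, hy0⟩
    subst hy
    exact ⟨y.2, hy0⟩

theorem mem_sandwich_domain {S T : K →L[ℂ] K} {x : K} :
    x ∈ (sandwich S Y T).domain ↔ T x ∈ Y.domain := Iff.rfl

theorem sandwich_apply {S T : K →L[ℂ] K} (x : (sandwich S Y T).domain) :
    sandwich S Y T x = S (Y ⟨T x, x.2⟩) := rfl

variable [CompleteSpace K] {M : VonNeumannAlgebra K} {d : (K →L[ℂ] K) → ℝ}

/-- An operator affiliated with `M` which agrees with elements of `M` on closed subspaces of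
relative dimension close to the maximal one. -/
structure IsMeasurableOp (M : VonNeumannAlgebra K) (d : (K →L[ℂ] K) → ℝ) (Y : K →ₗ.[ℂ] K) :
    Prop where
  commute : ∀ T ∈ M.commutant, ∀ x : Y.domain, ∃ h : T x ∈ Y.domain, Y ⟨T x, h⟩ = T (Y x)
  bounded : ∀ ε > 0, ∃ F, IsInvariant M F ∧ IsClosed (F : Set K) ∧ d 1 - ε < dim d F ∧
    ∃ y ∈ M, ∀ x ∈ F, ∃ h : x ∈ Y.domain, Y ⟨x, h⟩ = y x

theorem isFormalAdjoint_sandwich (h : Y.IsFormalAdjoint Y') (S T : K →L[ℂ] K) :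
    (sandwich S Y T).IsFormalAdjoint (sandwich (star T) Y' (star S)) := by
  intro x y
  rw [sandwich_apply, sandwich_apply, ContinuousLinearMap.star_eq_adjoint,
    ContinuousLinearMap.adjoint_inner_right, ← ContinuousLinearMap.adjoint_inner_right]
  exact h ⟨T x, x.2⟩ ⟨star S y, y.2⟩

theorem isClosable_of_isFormalAdjoint (h : Y.IsFormalAdjoint Y')
    (hd : Dense (Y'.domain : Set K)) : Y.IsClosable :=
  LinearPMap.isClosable_iff_exists_closed_extension.2
    ⟨_, LinearPMap.adjoint_isClosed hd, h.symm.le_adjoint hd⟩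

namespace IsMeasurableOp

theorem isInvariant_domain (hY : IsMeasurableOp M d Y) : IsInvariant M Y.domain :=
  fun T hT x hx => (hY.commute T hT ⟨x, hx⟩).1

theorem isInvariant_kernel (hY : IsMeasurableOp M d Y) : IsInvariant M (kernel Y) := by
  intro T hT x hx
  obtain ⟨h, hx⟩ := mem_kernel.1 hx
  obtain ⟨h', hx'⟩ := hY.commute T hT ⟨x, h⟩
  exact mem_kernel.2 ⟨h', by rw [hx', hx, map_zero]⟩

theorem sandwich (hY : IsMeasurableOp M d Y) (hd : IsDimTrace M d) {S T : K →L[ℂ] K}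
    (hS : S ∈ M) (hT : T ∈ M) : IsMeasurableOp M d (sandwich S Y T) where
  commute := by
    intro R hR x
    obtain ⟨h, hx⟩ := hY.commute R hR ⟨T x, x.2⟩
    have hc := apply_comm_of_mem_commutant hT hR (x : K)
    refine ⟨by rw [mem_sandwich_domain, hc]; exact h, ?_⟩
    rw [sandwich_apply, sandwich_apply, ← apply_comm_of_mem_commutant hS hR, ← hx]
    congr 2
    exact Subtype.ext hc
  bounded := by
    intro ε hε
    obtain ⟨F, hF, hFc, hdF, y, hy, h⟩ := hY.bounded ε hε
    refine ⟨F.comap T.toLinearMap, hF.comap hT, hFc.preimage T.continuous,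
      hdF.trans_le (hd.le_dim_comap hF hFc hT), S * y * T, mul_mem (mul_mem hS hy) hT, ?_⟩
    intro x hx
    obtain ⟨h', hx'⟩ := h (T x) hx
    exact ⟨h', congrArg S hx'⟩

theorem dense_domain (hY : IsMeasurableOp M d Y) (hd : IsDimTrace M d) :
    Dense (Y.domain : Set K) := by
  rw [Submodule.dense_iff_topologicalClosure_eq_top, eq_top_iff]
  refine hd.le_closure_of_forall isInvariant_top isClosed_univ hY.isInvariant_domain fun ε hε => ?_
  obtain ⟨F, hF, hFc, hdF, y, -, h⟩ := hY.bounded ε hε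
  exact ⟨F, hF, hFc, hdF, fun x hx => (h x hx.2).1⟩

/-- The kernel of an extension contains no closed invariant subspace other than those in the
closure of the kernel. -/
theorem le_closure_kernel (hY : IsMeasurableOp M d Y) (hd : IsDimTrace M d) (hZ : Y ≤ Z)
    {P : Submodule ℂ K} (hP : IsInvariant M P) (hPc : IsClosed (P : Set K)) (h : P ≤ kernel Z) :
    P ≤ (kernel Y).topologicalClosure := by
  refine hd.le_closure_of_forall hP hPc hY.isInvariant_kernel fun ε hε => ?_
  obtain ⟨F, hF, hFc, hdF, y, -, hFY⟩ := hY.bounded ε hε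
  refine ⟨F, hF, hFc, hdF, fun x hx => ?_⟩
  obtain ⟨h1, -⟩ := hFY x hx.2
  obtain ⟨h2, h3⟩ := mem_kernel.1 (h hx.1)
  exact mem_kernel.2 ⟨h1, (hZ.2 rfl).trans h3⟩

/-- Let `Y` agree with `y` on `F`. The kernel of `Y'` is orthogonal to `y F`, so by rank-nullity its
dimension is at most that of the kernel of `y * proj F`, which is the codimension of `F`, less than
`ε`, plus the dimension of `F ⊓ ker y`, a part of the kernel of `Y`. -/
theorem dim_kernel_le (hY : IsMeasurableOp M d Y) (hY' : IsMeasurableOp M d Y')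
    (hd : IsDimTrace M d) (h : Y.IsFormalAdjoint Y') :
    dim d (kernel Y') ≤ dim d (kernel Y) := by
  refine le_of_forall_pos_le_add fun ε hε => ?_
  obtain ⟨F, hF, hFc, hdF, y, hy, hFY⟩ := hY.bounded ε hε
  have hyF := mul_mem hy hF.proj_mem
  have h1 := hd.dim_ker_add_dim_range hyF
  rw [hd.dim_ker_mul_proj hF hFc hy] at h1
  have h2 : dim d (F ⊓ LinearMap.ker y.toLinearMap) ≤ dim d (kernel Y) := by
    refine hd.dim_mono (hF.inf (isInvariant_ker hy)) hY.isInvariant_kernel fun x hx => ?_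
    obtain ⟨hx1, hx2⟩ := hFY x hx.1
    exact mem_kernel.2 ⟨hx1, hx2.trans hx.2⟩
  have h3 : dim d (kernel Y') ≤ dim d (LinearMap.range (y * proj F).toLinearMap)ᗮ := by
    refine hd.dim_mono hY'.isInvariant_kernel (isInvariant_range hyF).orthogonal ?_
    rintro z hz _ ⟨x, rfl⟩
    obtain ⟨hz1, hz2⟩ := mem_kernel.1 hz
    obtain ⟨hx1, hx2⟩ := hFY (proj F x) (proj_apply_mem hFc x)
    have := h ⟨proj F x, hx1⟩ ⟨z, hz1⟩
    rw [hx2, hz2, inner_zero_right] at this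
    exact this
  rw [hd.dim_orthogonal (isInvariant_range hyF)] at h3
  linarith

theorem dim_kernel_eq (hY : IsMeasurableOp M d Y) (hY' : IsMeasurableOp M d Y')
    (hd : IsDimTrace M d) (h : Y.IsFormalAdjoint Y') :
    dim d (kernel Y) = dim d (kernel Y') :=
  le_antisymm (hY'.dim_kernel_le hY hd h.symm) (hY.dim_kernel_le hY' hd h)

/-- An operator with a bounded resolvent in `M` is measurable. -/
theorem of_resolvent (hd : IsDimTrace M d) (hdense : Dense (Y.domain : Set K)) {r a : K →L[ℂ] K}
    (hr : r ∈ M) (ha : a ∈ M) (h1 : ∀ x, ∃ h : r x ∈ Y.domain, Y ⟨r x, h⟩ = a x)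
    (h2 : ∀ x ∈ Y.domain, ∃ z, r z = x) : IsMeasurableOp M d Y where
  commute := by
    intro T hT x
    obtain ⟨z, hz⟩ := h2 x x.2
    obtain ⟨h3, h4⟩ := h1 z
    obtain ⟨h5, h6⟩ := h1 (T z)
    have h7 : T x = r (T z) := by rw [apply_comm_of_mem_commutant hr hT, hz]
    have h8 : Y x = a z := by
      rw [← h4]
      exact congrArg Y (Subtype.ext hz.symm)
    refine ⟨by rw [h7]; exact h5, ?_⟩
    rw [h8, ← apply_comm_of_mem_commutant ha hT, ← h6]
    exact congrArg Y (Subtype.ext h7)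
  bounded := by
    intro ε hε
    -- The range of `r` contains the domain of `Y`. Where `r` has the right inverse `b`, one has `Y
    -- x = Y (r (b x)) = a (b x)`.
    have hdr : DenseRange r := hdense.mono fun x hx => h2 x hx
    obtain ⟨F, hF, hFc, hdF, b, hb, hFb⟩ := hd.exists_rightInverse_of_dense hr hdr ε hε
    refine ⟨F, hF, hFc, hdF, a * b, mul_mem ha hb, fun x hx => ?_⟩
    obtain ⟨h3, h4⟩ := h1 (b x)
    refine ⟨by rw [← hFb x hx]; exact h3, ?_⟩
    change _ = a (b x)
    rw [← h4]
    congr 1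
    exact Subtype.ext (hFb x hx).symm

/-- Compressing by the complement of a projection orthogonal to the kernel adds this projection
to the kernel. -/
theorem dim_kernel_sandwich_sub (hd : IsDimTrace M d) {S q w : K →L[ℂ] K}
    (hY : IsMeasurableOp M d (TracialVN.sandwich S Y q)) (hw : w ∈ M) (hwp : IsStarProjection w)
    (hqw : q * w = w)
    (h0 : ∀ x ∈ kernel (TracialVN.sandwich S Y q), w x = 0) :
    dim d (kernel (TracialVN.sandwich S Y (q - w))) =
      dim d (kernel (TracialVN.sandwich S Y q)) + d w := by
  -- Because `q w = w`, one has `(q - w) x = q (x - w x)`: `x` is in the new kernel exactly when `x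
  -- - w x` is in the old one.
  have hker : kernel (TracialVN.sandwich S Y (q - w)) =
      kernel (TracialVN.sandwich S Y q) ⊔ LinearMap.range w.toLinearMap := by
    have hww : ∀ x, w (w x) = w x := fun x =>
      congrArg (fun T : K →L[ℂ] K => T x) hwp.isIdempotentElem.eq
    have hqw' : ∀ x, q (w x) = w x := fun x => congrArg (fun T : K →L[ℂ] K => T x) hqw
    have hmem : ∀ (T : K →L[ℂ] K) x, x ∈ kernel (TracialVN.sandwich S Y T) ↔
        ∃ h : T x ∈ Y.domain, S (Y ⟨T x, h⟩) = 0 := fun T x => mem_kernel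
    have hcongr : ∀ (T T' : K →L[ℂ] K) x y, T x = T' y →
        x ∈ kernel (TracialVN.sandwich S Y T) → y ∈ kernel (TracialVN.sandwich S Y T') := by
      intro T T' x y h hx
      obtain ⟨h1, h2⟩ := (hmem T x).1 hx
      refine (hmem T' y).2 ⟨h ▸ h1, ?_⟩
      rw [← h2]
      exact congrArg (fun z => S (Y z)) (Subtype.ext h.symm)
    apply le_antisymm
    · intro x hx
      refine Submodule.mem_sup.2 ⟨x - w x, ?_, w x, ⟨x, rfl⟩, sub_add_cancel _ _⟩
      refine hcongr (q - w) q x (x - w x) ?_ hx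
      rw [map_sub, hqw']
      rfl
    · refine sup_le (fun x hx => ?_) ?_
      · refine hcongr q (q - w) x x ?_ hx
        change q x = q x - w x
        rw [h0 x hx, sub_zero]
      · rintro _ ⟨x, rfl⟩
        refine hcongr q (q - w) 0 (w x) ?_ (zero_mem _)
        change q 0 = q (w x) - w (w x)
        rw [map_zero, hqw', hww, sub_self]
  have ho : LinearMap.range w.toLinearMap ≤ (kernel (TracialVN.sandwich S Y q))ᗮ := by
    rintro _ ⟨x, rfl⟩ y hy
    change inner ℂ y (w x) = 0
    rw [← ContinuousLinearMap.adjoint_inner_left, ← ContinuousLinearMap.star_eq_adjoint,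
      hwp.isSelfAdjoint.star_eq, h0 y hy, inner_zero_left]
  rw [hker, hd.dim_sup hY.isInvariant_kernel (isInvariant_range hw) ho, dim, dim,
    proj_range_of_isStarProjection hwp]

end IsMeasurableOp

end Unbounded

/-! ### The von Neumann algebra of matrices over `𝓐` and its trace -/

section Amplification

variable {H : Type u} [NormedAddCommGroup H] [InnerProductSpace ℂ H] {n : ℕ}

/-- The embedding of `H` as the `j`-th summand of `H ⊕ ⋯ ⊕ H`. -/
def incl (H : Type u) [NormedAddCommGroup H] [InnerProductSpace ℂ H] {n : ℕ} (j : Fin n) :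
    H →L[ℂ] Amp H n :=
  (PiLp.continuousLinearEquiv 2 ℂ (fun _ : Fin n => H)).symm.toContinuousLinearMap ∘L
    ContinuousLinearMap.single ℂ (fun _ : Fin n => H) j

theorem incl_apply (j : Fin n) (x : H) (i : Fin n) : incl H j x i = if i = j then x else 0 := by
  simp [incl]

/-- The diagonal operator `x ⊕ ⋯ ⊕ x`. -/
def diag (n : ℕ) (x : H →L[ℂ] H) : Amp H n →L[ℂ] Amp H n :=
  (PiLp.continuousLinearEquiv 2 ℂ (fun _ : Fin n => H)).symm.toContinuousLinearMap ∘L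
    ContinuousLinearMap.pi (fun i => x ∘L PiLp.proj 2 (fun _ => H) i)

@[simp]
theorem diag_apply (x : H →L[ℂ] H) (ξ : Amp H n) (i : Fin n) : diag n x ξ i = x (ξ i) := by
  simp [diag]

theorem sum_incl (ξ : Amp H n) : ∑ j, incl H j (ξ j) = ξ := by
  ext i
  simp [incl_apply]

theorem inner_incl_left (j : Fin n) (x : H) (ξ : Amp H n) :
    inner ℂ (incl H j x) ξ = inner ℂ x (ξ j) := by
  rw [PiLp.inner_apply, Finset.sum_eq_single j] <;> simp +contextual [incl_apply]

theorem diag_incl (x : H →L[ℂ] H) (j : Fin n) (y : H) :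
    diag n x (incl H j y) = incl H j (x y) := by
  ext i
  simp only [diag_apply, incl_apply]
  split <;> simp

variable [CompleteSpace H]

theorem adjoint_incl_apply (j : Fin n) (ξ : Amp H n) :
    ContinuousLinearMap.adjoint (incl H j) ξ = ξ j :=
  ext_inner_left ℂ fun x => by
    rw [ContinuousLinearMap.adjoint_inner_right, inner_incl_left]

/-- The matrix entries of an operator on `H ⊕ ⋯ ⊕ H`. -/
def entry (T : Amp H n →L[ℂ] Amp H n) (i j : Fin n) : H →L[ℂ] H :=
  ContinuousLinearMap.adjoint (incl H i) ∘L T ∘L incl H j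

theorem entry_apply (T : Amp H n →L[ℂ] Amp H n) (i j : Fin n) (x : H) :
    entry T i j x = T (incl H j x) i := adjoint_incl_apply i _

theorem sum_entry (T : Amp H n →L[ℂ] Amp H n) (ξ : Amp H n) (i : Fin n) :
    ∑ j, entry T i j (ξ j) = T ξ i := by
  conv_rhs => rw [← sum_incl ξ, map_sum]
  simp [entry_apply]

theorem entry_injective {S T : Amp H n →L[ℂ] Amp H n} (h : ∀ i j, entry S i j = entry T i j) :
    S = T := by
  ext ξ i
  simp_rw [← sum_entry, h]

variable {𝓐 : VonNeumannAlgebra H}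

theorem entry_matOp (a : Mat n 𝓐) (i j : Fin n) : entry (matOp a) i j = (a i j : H →L[ℂ] H) := by
  ext x
  rw [entry_apply, matOp_apply, Finset.sum_eq_single j] <;> simp +contextual [incl_apply]

theorem matOp_injective : Function.Injective fun a : Mat n 𝓐 => matOp a := by
  intro a b h
  refine Matrix.ext fun i j => Subtype.ext ?_
  rw [← entry_matOp a, ← entry_matOp b]
  exact congrArg (fun T => entry T i j) h

theorem entry_star (T : Amp H n →L[ℂ] Amp H n) (i j : Fin n) :
    entry (star T) i j = star (entry T j i) := by
  simp [entry, ContinuousLinearMap.star_eq_adjoint, ContinuousLinearMap.adjoint_comp,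
    ContinuousLinearMap.comp_assoc]

variable (𝓐) in
/-- The action of `M_n(𝓐)` on `H ⊕ ⋯ ⊕ H`, as a `*`-homomorphism. -/
def matOpHom (n : ℕ) : Mat n 𝓐 →⋆ₐ[ℂ] (Amp H n →L[ℂ] Amp H n) where
  toFun := matOp
  map_one' := by
    refine entry_injective fun i j => ?_
    ext x
    rw [entry_matOp, entry_apply, Matrix.one_apply]
    change _ = incl H j x i
    rw [incl_apply]
    split <;> simp
  map_mul' a b := by
    ext ξ i
    change _ = matOp a (matOp b ξ) i
    simp only [matOp_apply, Matrix.mul_apply, map_sum, AddSubmonoidClass.coe_finsetSum,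
      MulMemClass.coe_mul, sum_apply]
    exact Finset.sum_comm
  map_zero' := by
    ext ξ i
    simp
  map_add' a b := by
    ext ξ i
    simp [Finset.sum_add_distrib]
  commutes' c := by
    refine entry_injective fun i j => ?_
    ext x
    rw [entry_matOp, entry_apply, Matrix.algebraMap_matrix_apply]
    change _ = c • incl H j x i
    rw [incl_apply]
    split <;> simp [Algebra.algebraMap_eq_smul_one]
  map_star' a := by
    refine entry_injective fun i j => ?_
    rw [entry_star, entry_matOp, entry_matOp]
    rfl

variable (𝓐) in
/-- `M_n(𝓐)` as a von Neumann algebra on `H ⊕ ⋯ ⊕ H`. -/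
def amplification (n : ℕ) : VonNeumannAlgebra (Amp H n) where
  toStarSubalgebra := (matOpHom 𝓐 n).range
  centralizer_centralizer' := by
    refine Set.Subset.antisymm (fun T hT => ?_) Set.subset_centralizer_centralizer
    -- Commuting with the diagonal copies of the commutant of `𝓐` already places every matrix entry
    -- of `T` in the bicommutant `𝓐`.
    have hdiag : ∀ x ∈ 𝓐.commutant, diag n x * T = T * diag n x := by
      intro x hx
      refine Set.mem_centralizer_iff.1 hT _ (Set.mem_centralizer_iff.2 ?_)
      rintro _ ⟨a, rfl⟩
      ext ξ i
      change matOp a (diag n x ξ) i = diag n x (matOp a ξ) i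
      simp only [matOp_apply, diag_apply, map_sum]
      exact Finset.sum_congr rfl fun j _ => apply_comm_of_mem_commutant (a i j).2 hx _
    have hmem : ∀ i j, entry T i j ∈ 𝓐 := by
      intro i j
      refine mem_of_commute fun x hx y => ?_
      rw [entry_apply, entry_apply, ← diag_apply, ← diag_incl]
      exact congrArg (fun S : Amp H n →L[ℂ] Amp H n => S (incl H j y) i) (hdiag x hx).symm
    refine ⟨Matrix.of fun i j => ⟨entry T i j, hmem i j⟩, ?_⟩
    refine entry_injective fun i j => ?_
    exact entry_matOp _ i j

theorem mem_amplification {T : Amp H n →L[ℂ] Amp H n} :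
    T ∈ amplification 𝓐 n ↔ ∃ a : Mat n 𝓐, matOp a = T := Iff.rfl

theorem matOp_mem (a : Mat n 𝓐) : matOp a ∈ amplification 𝓐 n := ⟨a, rfl⟩

variable (τ : 𝓐.toStarSubalgebra →ₗ[ℂ] ℂ)

open scoped Classical in
/-- The real part of the trace `∑ τ(a_jj)`, as a function of the operator defined by `a`. -/
def opTrace (T : Amp H n →L[ℂ] Amp H n) : ℝ :=
  if h : ∃ a : Mat n 𝓐, matOp a = T then (∑ j, τ (h.choose j j)).re else 0

theorem opTrace_matOp (a : Mat n 𝓐) : opTrace τ (matOp a) = (∑ j, τ (a j j)).re := by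
  have h : ∃ b : Mat n 𝓐, matOp b = matOp a := ⟨a, rfl⟩
  rw [opTrace, dif_pos h, matOp_injective h.choose_spec]

theorem entry_mono {S T : Amp H n →L[ℂ] Amp H n} (h : S ≤ T) (j : Fin n) :
    entry S j j ≤ entry T j j := by
  rw [ContinuousLinearMap.le_def] at h ⊢
  have := h.adjoint_conj (incl H j)
  convert this using 1
  ext x
  simp [entry]

theorem entry_nonneg {T : Amp H n →L[ℂ] Amp H n} (h : 0 ≤ T) (j : Fin n) : 0 ≤ entry T j j := by
  have := entry_mono h j
  convert this using 1
  ext x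
  simp [entry]

theorem entry_one_self (j : Fin n) : entry (1 : Amp H n →L[ℂ] Amp H n) j j = 1 := by
  ext x
  rw [entry_apply]
  change incl H j x j = x
  simp [incl_apply]

theorem isLUB_one_of_tendsto {c : ℕ → H →L[ℂ] H} (h0 : ∀ k, 0 ≤ c k) (h1 : ∀ k, c k ≤ 1)
    (h : ∀ x, Tendsto (fun k => c k x) atTop (𝓝 x)) : IsLUB (Set.range c) 1 := by
  refine ⟨by rintro _ ⟨k, rfl⟩; exact h1 k, fun b hb => ?_⟩
  have hb' : ∀ k, c k ≤ b := fun k => hb ⟨k, rfl⟩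
  rw [ContinuousLinearMap.le_def, ContinuousLinearMap.isPositive_def']
  have hbsa : IsSelfAdjoint b := ((h0 0).trans (hb' 0)).isSelfAdjoint
  refine ⟨hbsa.sub (.one _), fun x => ?_⟩
  have hlim : Tendsto (fun k => (inner ℂ ((b - c k) x) x).re) atTop
      (𝓝 (inner ℂ ((b - 1) x) x).re) :=
    (Complex.continuous_re.tendsto _).comp ((tendsto_const_nhds.sub (h x)).inner tendsto_const_nhds)
  exact ge_of_tendsto' hlim fun k =>
    ((ContinuousLinearMap.le_def _ _).1 (hb' k)).re_inner_nonneg_left x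

theorem matOp_mul (a b : Mat n 𝓐) : matOp (a * b) = matOp a * matOp b := map_mul (matOpHom 𝓐 n) a b

theorem matOp_star (a : Mat n 𝓐) : matOp (star a) = star (matOp a) := map_star (matOpHom 𝓐 n) a

theorem matOp_add (a b : Mat n 𝓐) : matOp (a + b) = matOp a + matOp b := map_add (matOpHom 𝓐 n) a b

theorem matOp_sub (a b : Mat n 𝓐) : matOp (a - b) = matOp a - matOp b := map_sub (matOpHom 𝓐 n) a b

theorem matOp_one : matOp (1 : Mat n 𝓐) = 1 := map_one (matOpHom 𝓐 n)

theorem isStarProjection_matOp_iff {a : Mat n 𝓐} :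
    IsStarProjection (matOp a) ↔ IsStarProjection a := by
  constructor
  · intro h
    exact ⟨matOp_injective ((matOp_mul a a).trans h.isIdempotentElem.eq),
      matOp_injective ((matOp_star a).trans h.isSelfAdjoint.star_eq)⟩
  · exact fun h => h.map (matOpHom 𝓐 n)

variable {τ}

theorem trace_star_mul_self_re_nonneg (hτ : IsFaithfulNormalTraceState 𝓐 τ) (a : Mat n 𝓐)
    (j : Fin n) : 0 ≤ (τ ((star a * a) j j)).re := by
  rw [Matrix.mul_apply, map_sum, Complex.re_sum]
  exact Finset.sum_nonneg fun i _ => (hτ.nonneg (a i j)).1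

theorem trace_star_mul_self_im (hτ : IsFaithfulNormalTraceState 𝓐 τ) (a : Mat n 𝓐) (j : Fin n) :
    (τ ((star a * a) j j)).im = 0 := by
  rw [Matrix.mul_apply, map_sum, Complex.im_sum]
  exact Finset.sum_eq_zero fun i _ => (hτ.nonneg (a i j)).2

/-- The projections increase strongly to `1`, hence so do their diagonal entries, and normality of
`τ` applies to each of these finitely many entries. -/
theorem opTrace_normal (hτ : IsFaithfulNormalTraceState 𝓐 τ) (F : ℕ → Submodule ℂ (Amp H n))
    (hmono : Monotone F) (hF : ∀ k, IsInvariant (amplification 𝓐 n) (F k))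
    (hdense : (⨆ k, F k).topologicalClosure = ⊤) (ε : ℝ) (hε : 0 < ε) :
    ∃ k, opTrace τ (1 : Amp H n →L[ℂ] Amp H n) - ε < opTrace τ (proj (F k)) := by
  choose p hp using fun k => mem_amplification.1 (hF k).proj_mem
  have hpj : ∀ k j, (p k j j : H →L[ℂ] H) = entry (proj (F k)) j j := fun k j => by
    rw [← hp k, entry_matOp]
  have hlim : ∀ ξ, Tendsto (fun k => proj (F k) ξ) atTop (𝓝 ξ) := by
    intro ξ
    refine Submodule.starProjection_tendsto_self (fun k => (F k).topologicalClosure)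
      (fun j k h => Submodule.topologicalClosure_mono (hmono h)) ξ ?_
    rw [← hdense]
    exact Submodule.topologicalClosure_mono (iSup_mono fun k => (F k).le_topologicalClosure)
  have hple : ∀ {j k}, j ≤ k → proj (F j) ≤ proj (F k) := fun h =>
    (isStarProjection_proj _).le_of_mul_eq_right (isStarProjection_proj _)
      (proj_mul_proj_of_le ((hmono h).trans (Submodule.le_topologicalClosure _)))
  have hτmono : ∀ j, Monotone fun k => (τ (p k j j)).re := by
    intro j k l hkl
    have hq : IsStarProjection (p l - p k) := by
      rw [← isStarProjection_matOp_iff, matOp_sub, hp, hp]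
      exact IsDimTrace.isStarProjection_sub_of_le
        ((hmono hkl).trans (Submodule.le_topologicalClosure _))
    have := trace_star_mul_self_re_nonneg hτ (p l - p k) j
    rw [hq.isSelfAdjoint.star_eq, hq.isIdempotentElem.eq, Matrix.sub_apply, map_sub,
      Complex.sub_re] at this
    exact sub_nonneg.1 this
  have hτlim : ∀ j, Tendsto (fun k => (τ (p k j j)).re) atTop (𝓝 1) := by
    intro j
    have h1 := hτ.normal (Set.range fun k => p k j j) 1 (Set.range_nonempty _)
      (by
        rintro _ ⟨k, rfl⟩
        change 0 ≤ (p k j j : H →L[ℂ] H)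
        rw [hpj]
        exact entry_nonneg (isStarProjection_proj _).nonneg j)
      (by
        rw [directedOn_range]
        refine Monotone.directed_le fun k l hkl => ?_
        change (p k j j : H →L[ℂ] H) ≤ p l j j
        rw [hpj, hpj]
        exact entry_mono (hple hkl) j)
      (by
        rw [← Set.range_comp]
        refine isLUB_one_of_tendsto (fun k => ?_) (fun k => ?_) fun x => ?_
        · simp only [Function.comp_apply, hpj]
          exact entry_nonneg (isStarProjection_proj _).nonneg j
        · simp only [Function.comp_apply, hpj]
          have h1 : proj (F k) ≤ 1 := (isStarProjection_proj _).le_one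
          exact (entry_mono h1 j).trans_eq (entry_one_self j)
        · simp only [Function.comp_apply, hpj, entry_apply]
          have := ((PiLp.proj 2 (fun _ : Fin n => H) (𝕜 := ℂ) j).continuous.tendsto _).comp
            (hlim (incl H j x))
          simpa [Function.comp_def, incl_apply] using this)
    rw [← Set.range_comp, hτ.map_one] at h1
    exact tendsto_atTop_isLUB (hτmono j) h1
  have hsum : Tendsto (fun k => opTrace τ (proj (F k))) atTop
      (𝓝 (opTrace τ (1 : Amp H n →L[ℂ] Amp H n))) := by
    rw [← matOp_one (𝓐 := 𝓐), opTrace_matOp]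
    simp_rw [← hp, opTrace_matOp, Complex.re_sum]
    refine tendsto_finsetSum _ fun j _ => ?_
    simpa [hτ.map_one] using hτlim j
  exact (hsum.eventually_const_lt (sub_lt_self _ hε)).exists

theorem isDimTrace_opTrace (hτ : IsFaithfulNormalTraceState 𝓐 τ) :
    IsDimTrace (amplification 𝓐 n) (opTrace τ) where
  map_add := by
    rintro _ ⟨a, rfl⟩ _ ⟨b, rfl⟩
    change opTrace τ (matOp a + matOp b) = opTrace τ (matOp a) + opTrace τ (matOp b)
    rw [← matOp_add, opTrace_matOp, opTrace_matOp, opTrace_matOp]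
    simp [Finset.sum_add_distrib]
  nonneg := by
    rintro _ ⟨a, rfl⟩
    change 0 ≤ opTrace τ (star (matOp a) * matOp a)
    rw [← matOp_star, ← matOp_mul, opTrace_matOp, Complex.re_sum]
    exact Finset.sum_nonneg fun j _ => trace_star_mul_self_re_nonneg hτ a j
  comm := by
    rintro _ ⟨a, rfl⟩ _ ⟨b, rfl⟩
    change opTrace τ (matOp a * matOp b) = opTrace τ (matOp b * matOp a)
    rw [← matOp_mul, ← matOp_mul, opTrace_matOp, opTrace_matOp]
    simp_rw [Matrix.mul_apply, map_sum]
    rw [Finset.sum_comm]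
    simp_rw [hτ.trace]
  faithful := by
    rintro _ ⟨a, rfl⟩ h
    change opTrace τ (star (matOp a) * matOp a) = 0 at h
    change matOp a = 0
    rw [← matOp_star, ← matOp_mul, opTrace_matOp, Complex.re_sum,
      Finset.sum_eq_zero_iff_of_nonneg fun j _ => trace_star_mul_self_re_nonneg hτ a j] at h
    have ha : a = 0 := by
      refine Matrix.ext fun i j => hτ.faithful _ ?_
      have hj := h j (Finset.mem_univ j)
      rw [Matrix.mul_apply, map_sum, Complex.re_sum] at hj
      exact Complex.ext ((Finset.sum_eq_zero_iff_of_nonneg fun i _ => (hτ.nonneg (a i j)).1).1 hj i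
        (Finset.mem_univ i)) (hτ.nonneg (a i j)).2
    rw [ha]
    exact map_zero (matOpHom 𝓐 n)
  normal := opTrace_normal hτ

end Amplification

/-! ### Scalar matrices and the conditional expectation -/

section ScalarMatrices

variable {H : Type u} [NormedAddCommGroup H] [InnerProductSpace ℂ H] [CompleteSpace H] {n : ℕ}
  {𝓐 : VonNeumannAlgebra H} {τ : 𝓐.toStarSubalgebra →ₗ[ℂ] ℂ}

theorem scalarMat_mul (q r : Matrix (Fin n) (Fin n) ℂ) :
    scalarMat 𝓐 (q * r) = scalarMat 𝓐 q * scalarMat 𝓐 r :=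
  Matrix.map_mul (f := algebraMap ℂ 𝓐.toStarSubalgebra)

theorem scalarMat_sub (q r : Matrix (Fin n) (Fin n) ℂ) :
    scalarMat 𝓐 (q - r) = scalarMat 𝓐 q - scalarMat 𝓐 r :=
  Matrix.map_sub _ (map_sub (algebraMap ℂ 𝓐.toStarSubalgebra)) q r

theorem scalarMat_one : scalarMat 𝓐 (1 : Matrix (Fin n) (Fin n) ℂ) = 1 :=
  Matrix.map_one _ (map_zero (algebraMap ℂ 𝓐.toStarSubalgebra)) (map_one _)

theorem scalarMat_star (q : Matrix (Fin n) (Fin n) ℂ) :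
    scalarMat 𝓐 (star q) = star (scalarMat 𝓐 q) :=
  Matrix.conjTranspose_map (A := q) _ fun c => algebraMap_star_comm (A := 𝓐.toStarSubalgebra) c

theorem isStarProjection_scalarMat {q : Matrix (Fin n) (Fin n) ℂ} (hq : IsStarProjection q) :
    IsStarProjection (scalarMat 𝓐 q) :=
  ⟨by rw [IsIdempotentElem, ← scalarMat_mul, hq.isIdempotentElem.eq],
    by rw [IsSelfAdjoint, ← scalarMat_star, hq.isSelfAdjoint.star_eq]⟩

theorem condExpMat_mul_scalarMat (a : Mat n 𝓐) (q : Matrix (Fin n) (Fin n) ℂ) :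
    condExpMat τ (a * scalarMat 𝓐 q) = condExpMat τ a * q := by
  ext i j
  simp only [condExpMat, Matrix.of_apply, Matrix.mul_apply, map_sum, scalarMat, Matrix.map_apply]
  refine Finset.sum_congr rfl fun k _ => ?_
  rw [Algebra.algebraMap_eq_smul_one, mul_smul_comm, mul_one, map_smul, smul_eq_mul, mul_comm]

theorem condExpMat_scalarMat (hτ : IsFaithfulNormalTraceState 𝓐 τ)
    (q : Matrix (Fin n) (Fin n) ℂ) : condExpMat τ (scalarMat 𝓐 q) = q := by
  have h1 : condExpMat τ (1 : Mat n 𝓐) = 1 := by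
    ext i j
    rw [condExpMat, Matrix.of_apply, Matrix.one_apply, Matrix.one_apply]
    split <;> simp [hτ.map_one]
  rw [← one_mul (scalarMat 𝓐 q), condExpMat_mul_scalarMat, h1, one_mul]

theorem scalarMat_injective (hτ : IsFaithfulNormalTraceState 𝓐 τ) :
    Function.Injective (scalarMat (n := n) 𝓐) :=
  Function.LeftInverse.injective (condExpMat_scalarMat hτ)

theorem opTrace_matOp_eq_trace_condExpMat (a : Mat n 𝓐) :
    opTrace τ (matOp a) = (Matrix.trace (condExpMat τ a)).re := opTrace_matOp τ a

theorem card_mul_traceMat (a : Mat n 𝓐) : (n : ℂ) * traceMat τ a = ∑ j, τ (a j j) := by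
  rcases Nat.eq_zero_or_pos n with rfl | hn
  · simp
  · rw [traceMat, ← mul_assoc, mul_one_div_cancel (Nat.cast_ne_zero.2 hn.ne'), one_mul]

/-- For a projection `a = star a * a`, so the complex trace is real and nothing is lost in
`opTrace`. -/
theorem card_mul_traceMat_of_isStarProjection (hτ : IsFaithfulNormalTraceState 𝓐 τ) {a : Mat n 𝓐}
    (ha : IsStarProjection a) : (n : ℂ) * traceMat τ a = (opTrace τ (matOp a) : ℂ) := by
  rw [card_mul_traceMat, opTrace_matOp]
  refine Complex.ext (Complex.ofReal_re _).symm ?_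
  rw [Complex.ofReal_im, Complex.im_sum]
  refine Finset.sum_eq_zero fun j _ => ?_
  have := trace_star_mul_self_im hτ a j
  rwa [ha.isSelfAdjoint.star_eq, ha.isIdempotentElem.eq] at this

/-- A singular matrix annihilates a projection of rank one. -/
theorem exists_rankOne_projection {E : Matrix (Fin n) (Fin n) ℂ} (hE : ¬IsUnit E) :
    ∃ w : Matrix (Fin n) (Fin n) ℂ, IsStarProjection w ∧ E * w = 0 ∧ w.trace = 1 := by
  obtain ⟨v, hv, hEv⟩ : ∃ v ≠ 0, E.mulVec v = 0 := by
    rw [Matrix.exists_mulVec_eq_zero_iff]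
    by_contra h
    exact hE ((Matrix.isUnit_iff_isUnit_det E).2 (isUnit_iff_ne_zero.2 h))
  set c : ℂ := star v ⬝ᵥ v
  have hc : c ≠ 0 := by
    open scoped ComplexOrder in
    exact fun h => hv (dotProduct_star_self_eq_zero.1 h)
  have hcs : star c = c := (Matrix.star_dotProduct v v).symm
  refine ⟨c⁻¹ • Matrix.vecMulVec v (star v), ⟨?_, ?_⟩, ?_, ?_⟩
  · rw [IsIdempotentElem, Matrix.smul_mul, Matrix.mul_smul, Matrix.vecMulVec_mul_vecMulVec,
      Matrix.vecMulVec_smul, smul_smul, smul_smul, mul_assoc, inv_mul_cancel₀ hc, mul_one]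
  · rw [IsSelfAdjoint, star_smul, star_inv₀, hcs, Matrix.star_eq_conjTranspose,
      Matrix.conjTranspose_vecMulVec, star_star]
  · rw [Matrix.mul_smul, Matrix.mul_vecMulVec, hEv, Matrix.zero_vecMulVec, smul_zero]
  · rw [Matrix.trace_smul, Matrix.trace_vecMulVec, dotProduct_comm, smul_eq_mul]
    exact inv_mul_cancel₀ hc

end ScalarMatrices

/-! ### Kernels of compressions and the growth step -/

section Main

variable {H : Type u} [NormedAddCommGroup H] [InnerProductSpace ℂ H] [CompleteSpace H] {n : ℕ}
  {𝓐 : VonNeumannAlgebra H} {τ : 𝓐.toStarSubalgebra →ₗ[ℂ] ℂ}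
  {X Y Z : Amp H n →ₗ.[ℂ] Amp H n}

theorem annihilates_iff {a : Mat n 𝓐} :
    Annihilates Z a ↔ LinearMap.range (matOp a).toLinearMap ≤ kernel Z := by
  constructor
  · rintro h _ ⟨ξ, rfl⟩
    exact mem_kernel.2 (h ξ)
  · exact fun h ξ => mem_kernel.1 (h ⟨ξ, rfl⟩)

/-- Projections in `M_n(𝓐)` correspond to closed invariant subspaces, so `ker Z` is the projection
onto the greatest such subspace inside the kernel. -/
theorem isKer_of_greatest {L : Submodule ℂ (Amp H n)} {p : Mat n 𝓐} (hp : matOp p = proj L)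
    (hLc : IsClosed (L : Set (Amp H n))) (hL : L ≤ kernel Z)
    (h : ∀ P, IsInvariant (amplification 𝓐 n) P → IsClosed (P : Set (Amp H n)) →
      P ≤ kernel Z → P ≤ L) : IsKer Z p where
  isStarProjection := isStarProjection_matOp_iff.1 (hp ▸ isStarProjection_proj L)
  annihilates := annihilates_iff.2 <| by
    rintro _ ⟨ξ, rfl⟩
    rw [hp]
    exact hL (proj_apply_mem hLc ξ)
  greatest := by
    intro r hr hZ
    have hr' := isStarProjection_matOp_iff.2 hr
    have hle := h _ (isInvariant_range (matOp_mem r)) 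
      (ContinuousLinearMap.IsIdempotentElem.isClosed_range hr'.isIdempotentElem)
      (annihilates_iff.1 hZ)
    refine matOp_injective ?_
    change matOp (p * r) = matOp r
    rw [matOp_mul, hp]
    ext1 ξ
    exact proj_apply_of_mem (hle ⟨ξ, rfl⟩)

/-- The closure vanishes on the closure of the kernel of `Y`, and by measurability of `Y` its kernel
contains no larger closed invariant subspace. Dimensions can thus be computed before closing. -/
theorem IsMeasurableOp.exists_isKer_closure {d : (Amp H n →L[ℂ] Amp H n) → ℝ}
    (hY : IsMeasurableOp (amplification 𝓐 n) d Y) (hd : IsDimTrace (amplification 𝓐 n) d)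
    (hc : Y.IsClosable) : ∃ p : Mat n 𝓐, IsKer Y.closure p ∧ matOp p = proj (kernel Y) := by
  obtain ⟨p, hp⟩ := mem_amplification.1 hY.isInvariant_kernel.proj_mem
  refine ⟨p, isKer_of_greatest (L := (kernel Y).topologicalClosure) ?_
    (Submodule.isClosed_topologicalClosure _) (closure_kernel_le hc)
    fun P hP hPc hle => hY.le_closure_kernel hd Y.le_closure hP hPc hle, hp⟩
  rw [hp, proj, proj]
  simp only [(Submodule.isClosed_topologicalClosure (kernel Y)).submodule_topologicalClosure_eq]

theorem IsMeasurableOp.exists_isKer {d : (Amp H n →L[ℂ] Amp H n) → ℝ}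
    (hY : IsMeasurableOp (amplification 𝓐 n) d Y) (hc : Y.IsClosed) :
    ∃ p : Mat n 𝓐, IsKer Y p ∧ matOp p = proj (kernel Y) := by
  obtain ⟨p, hp⟩ := mem_amplification.1 hY.isInvariant_kernel.proj_mem
  exact ⟨p, isKer_of_greatest hp (isClosed_kernel hc) le_rfl fun P _ _ hle => hle, hp⟩

theorem IsRandomVariable.isMeasurableOp (hX : IsRandomVariable 𝓐 X)
    (hτ : IsFaithfulNormalTraceState 𝓐 τ) : IsMeasurableOp (amplification 𝓐 n) (opTrace τ) X := by
  obtain ⟨r, h1, h2⟩ := hX.resolvent_mem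
  refine .of_resolvent (isDimTrace_opTrace hτ) hX.selfAdjoint.dense_domain (matOp_mem r)
    -- From `(i - X) r = 1` one reads off `X r = i r - 1`.
    (a := Complex.I • matOp r - 1) ?_ (fun ξ => ?_) fun x hx => ⟨_, h2 ⟨x, hx⟩⟩
  · exact sub_mem (SMulMemClass.smul_mem (s := (amplification 𝓐 n).toStarSubalgebra)
      Complex.I (matOp_mem r)) (one_mem (amplification 𝓐 n))
  · obtain ⟨h, h'⟩ := h1 ξ
    exact ⟨h, (sub_eq_iff_eq_add.1 h' ▸ by simp : _ = Complex.I • matOp r ξ - ξ)⟩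

theorem IsRandomVariable.isFormalAdjoint (hX : IsRandomVariable 𝓐 X) : X.IsFormalAdjoint X := by
  have := LinearPMap.adjoint_isFormalAdjoint hX.selfAdjoint.dense_domain
  rwa [LinearPMap.isSelfAdjoint_def.1 hX.selfAdjoint] at this

theorem IsMeasurableOp.compression {d : (Amp H n →L[ℂ] Amp H n) → ℝ}
    (hX : IsMeasurableOp (amplification 𝓐 n) d X) (hd : IsDimTrace (amplification 𝓐 n) d)
    (q₁ q₂ : Matrix (Fin n) (Fin n) ℂ) :
    IsMeasurableOp (amplification 𝓐 n) d (compression 𝓐 q₁ X q₂) :=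
  hX.sandwich hd (matOp_mem _) (matOp_mem _)

theorem isFormalAdjoint_compression (hX : X.IsFormalAdjoint X)
    {q₁ q₂ : Matrix (Fin n) (Fin n) ℂ} (h₁ : IsStarProjection q₁) (h₂ : IsStarProjection q₂) :
    (compression 𝓐 q₁ X q₂).IsFormalAdjoint (compression 𝓐 q₂ X q₁) := by
  have := isFormalAdjoint_sandwich hX (matOp (scalarMat 𝓐 q₁)) (matOp (scalarMat 𝓐 q₂))
  rwa [← matOp_star, ← matOp_star, ← scalarMat_star, ← scalarMat_star,
    h₁.isSelfAdjoint.star_eq, h₂.isSelfAdjoint.star_eq] at this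

theorem kernel_compression_one : kernel (compression 𝓐 1 X 1) = kernel X := by
  ext x
  have h1 : matOp (scalarMat 𝓐 (1 : Matrix (Fin n) (Fin n) ℂ)) = 1 := by
    rw [scalarMat_one, matOp_one]
  rw [compression, h1]
  exact mem_kernel.trans mem_kernel.symm

/-- If the conditional expectation of the kernel of a compression is singular, the compression can
be shrunk in such a way that the dimension of the kernel increases by one. -/
theorem exists_dim_kernel_compression_eq_add_one (hτ : IsFaithfulNormalTraceState 𝓐 τ)
    (hX : IsMeasurableOp (amplification 𝓐 n) (opTrace τ) X) {q₁ q₂ : Matrix (Fin n) (Fin n) ℂ}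
    (h₂ : IsStarProjection q₂) {p : Mat n 𝓐}
    (hp : matOp p = proj (kernel (compression 𝓐 q₁ X q₂))) (hE : ¬IsUnit (condExpMat τ p)) :
    ∃ q : Matrix (Fin n) (Fin n) ℂ, IsStarProjection q ∧
      dim (opTrace τ) (kernel (compression 𝓐 q₁ X q)) =
        dim (opTrace τ) (kernel (compression 𝓐 q₁ X q₂)) + 1 := by
  have hd := isDimTrace_opTrace (n := n) hτ
  obtain ⟨w, hw, hEw, htr⟩ := exists_rankOne_projection hE
  have hw' := isStarProjection_scalarMat (𝓐 := 𝓐) hw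
  have hps : IsStarProjection p := isStarProjection_matOp_iff.1 (hp ▸ isStarProjection_proj _)
  -- The trace of `star (p w) * (p w)` equals that of `p w`, hence of `E_n(p) w = 0`.
  have hpw : p * scalarMat 𝓐 w = 0 := by
    refine matOp_injective (hd.faithful _ (matOp_mem _) ?_ |>.trans (map_zero (matOpHom 𝓐 n)).symm)
    have h1 : star (p * scalarMat 𝓐 w) * (p * scalarMat 𝓐 w) =
        scalarMat 𝓐 w * (p * scalarMat 𝓐 w) := by
      rw [star_mul, hps.isSelfAdjoint.star_eq, hw'.isSelfAdjoint.star_eq, mul_assoc,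
        ← mul_assoc p p, hps.isIdempotentElem.eq]
    rw [← matOp_star, ← matOp_mul, h1, matOp_mul, hd.comm _ (matOp_mem _) _ (matOp_mem _),
      ← matOp_mul, mul_assoc, hw'.isIdempotentElem.eq, opTrace_matOp_eq_trace_condExpMat,
      condExpMat_mul_scalarMat, hEw, Matrix.trace_zero, Complex.zero_re]
  have hwp : scalarMat 𝓐 w * p = 0 := by
    have := congrArg star hpw
    rwa [star_mul, hps.isSelfAdjoint.star_eq, hw'.isSelfAdjoint.star_eq, star_zero] at this
  have h0 : ∀ x ∈ kernel (compression 𝓐 q₁ X q₂), matOp (scalarMat 𝓐 w) x = 0 := by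
    intro x hx
    rw [← proj_apply_of_mem hx, ← hp]
    change (matOp (scalarMat 𝓐 w) * matOp p) x = 0
    rw [← matOp_mul, hwp]
    exact congrArg (fun T : Amp H n →L[ℂ] Amp H n => T x) (map_zero (matOpHom 𝓐 n))
  -- The range of `1 - q₂` lies in the kernel of the compression, which `w` annihilates.
  have hwq : w * q₂ = w := by
    have h1 : scalarMat 𝓐 (w * (1 - q₂)) = 0 := by
      refine matOp_injective ?_
      change matOp _ = matOp 0
      rw [scalarMat_mul, matOp_mul]
      ext1 x
      refine (h0 _ ?_).trans
        (congrArg (fun T : Amp H n →L[ℂ] Amp H n => T x) (map_zero (matOpHom 𝓐 n))).symm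
      have h2 : matOp (scalarMat 𝓐 q₂) (matOp (scalarMat 𝓐 (1 - q₂)) x) = 0 := by
        change (matOp (scalarMat 𝓐 q₂) * matOp (scalarMat 𝓐 (1 - q₂)) :
          Amp H n →L[ℂ] Amp H n) x = 0
        rw [← matOp_mul, ← scalarMat_mul, mul_sub, mul_one, h₂.isIdempotentElem.eq, sub_self,
          scalarMat, Matrix.map_zero _ (map_zero _)]
        exact congrArg (fun T : Amp H n →L[ℂ] Amp H n => T x) (map_zero (matOpHom 𝓐 n))
      have h3 : matOp (scalarMat 𝓐 (1 - q₂)) x ∈ (compression 𝓐 q₁ X q₂).domain :=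
        mem_sandwich_domain.2 (h2 ▸ zero_mem _)
      refine mem_kernel.2 ⟨h3, ?_⟩
      refine (sandwich_apply _).trans ?_
      have h4 : X ⟨matOp (scalarMat 𝓐 q₂) (matOp (scalarMat 𝓐 (1 - q₂)) x), h3⟩ = 0 :=
        (congrArg X (Subtype.ext h2)).trans X.map_zero
      exact (congrArg _ h4).trans (map_zero _)
    have h2 : w * (1 - q₂) = 0 := scalarMat_injective (𝓐 := 𝓐) hτ (h1.trans
      (Matrix.map_zero _ (map_zero (algebraMap ℂ 𝓐.toStarSubalgebra))).symm)
    rw [mul_sub, mul_one, sub_eq_zero] at h2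
    exact h2.symm
  have hqw : q₂ * w = w := by
    have := congrArg star hwq
    rwa [star_mul, h₂.isSelfAdjoint.star_eq, hw.isSelfAdjoint.star_eq] at this
  refine ⟨q₂ - w, hw.sub_of_mul_eq_left h₂ hwq, ?_⟩
  have h3 := IsMeasurableOp.dim_kernel_sandwich_sub hd (hX.compression hd q₁ q₂)
    (matOp_mem (scalarMat 𝓐 w)) (isStarProjection_matOp_iff.2 hw')
    (by rw [← matOp_mul, ← scalarMat_mul, hqw]) h0
  rw [← matOp_sub, ← scalarMat_sub, opTrace_matOp_eq_trace_condExpMat, condExpMat_scalarMat hτ,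
    htr, Complex.one_re] at h3
  exact h3

end Main

end TracialVN

end

theorem mainTheorem7 {H : Type*} [NormedAddCommGroup H] [InnerProductSpace ℂ H] [CompleteSpace H]
    (𝓐 : VonNeumannAlgebra H) (τ : 𝓐.toStarSubalgebra →ₗ[ℂ] ℂ)
    (hτ : TracialVN.IsFaithfulNormalTraceState 𝓐 τ) (n : ℕ)
    (X : TracialVN.Amp H n →ₗ.[ℂ] TracialVN.Amp H n) (hX : TracialVN.IsRandomVariable 𝓐 X) :
    ∃ q₁ q₂ : Matrix (Fin n) (Fin n) ℂ, IsStarProjection q₁ ∧ IsStarProjection q₂ ∧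
      (Dense ((TracialVN.compression 𝓐 q₁ X q₂).domain : Set (TracialVN.Amp H n)) ∧
        (TracialVN.compression 𝓐 q₁ X q₂).IsClosable) ∧
      (Dense ((TracialVN.compression 𝓐 q₂ X q₁).domain : Set (TracialVN.Amp H n)) ∧
        (TracialVN.compression 𝓐 q₂ X q₁).IsClosable) ∧
      ∃ p p₁₂ p₂₁ : TracialVN.Mat n 𝓐,
        TracialVN.IsKer X p ∧
        TracialVN.IsKer (TracialVN.compression 𝓐 q₁ X q₂).closure p₁₂ ∧
        TracialVN.IsKer (TracialVN.compression 𝓐 q₂ X q₁).closure p₂₁ ∧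
        IsUnit (TracialVN.condExpMat τ p₁₂) ∧
        IsUnit (TracialVN.condExpMat τ p₂₁) ∧
        ∃ k : ℤ,
          (n : ℂ) * TracialVN.traceMat τ p₁₂ - (n : ℂ) * TracialVN.traceMat τ p = (k : ℂ) ∧
          (n : ℂ) * TracialVN.traceMat τ p₂₁ - (n : ℂ) * TracialVN.traceMat τ p = (k : ℂ) := by
  open TracialVN in
  classical
  have hd := isDimTrace_opTrace (n := n) hτ
  have hXm := hX.isMeasurableOp hτ
  have hXa := hX.isFormalAdjoint
  let δ : Matrix (Fin n) (Fin n) ℂ → Matrix (Fin n) (Fin n) ℂ → ℝ := fun q₁ q₂ =>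
    dim (opTrace τ) (kernel (compression 𝓐 q₁ X q₂))
  let P : ℕ → Prop := fun k => ∃ q₁ q₂, IsStarProjection q₁ ∧ IsStarProjection q₂ ∧
    δ q₁ q₂ = dim (opTrace τ) (kernel X) + k
  have hP0 : P 0 := ⟨1, 1, .one _, .one _, by simp [δ, kernel_compression_one]⟩
  -- All dimensions lie between `0` and the trace of `1`, which is `n`.
  have hPn : ∀ k, P k → k ≤ n := by
    rintro k ⟨q₁, q₂, -, -, hk⟩
    have h1 := hd.dim_le (hXm.compression hd q₁ q₂).isInvariant_kernel
    have h2 := hd.dim_nonneg hXm.isInvariant_kernel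
    have h3 : opTrace τ (1 : Amp H n →L[ℂ] Amp H n) = n := by
      rw [← matOp_one (𝓐 := 𝓐), opTrace_matOp]
      simp [hτ.map_one]
    have : (k : ℝ) ≤ n := by
      change δ q₁ q₂ ≤ _ at h1
      linarith
    exact_mod_cast this
  set k := Nat.findGreatest P n
  have hk : P k := Nat.findGreatest_spec (Nat.zero_le n) hP0
  have hk' : ¬P (k + 1) := fun h =>
    absurd (Nat.le_findGreatest (hPn _ h) h) (Nat.not_succ_le_self k)
  obtain ⟨q₁, q₂, h₁, h₂, hq⟩ := hk
  have hm₁₂ := hXm.compression hd q₁ q₂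
  have hm₂₁ := hXm.compression hd q₂ q₁
  have ha := isFormalAdjoint_compression (𝓐 := 𝓐) hXa h₁ h₂
  have hq' : δ q₂ q₁ = dim (opTrace τ) (kernel X) + k :=
    (hm₁₂.dim_kernel_eq hm₂₁ hd ha).symm.trans hq
  have hc₁₂ := isClosable_of_isFormalAdjoint ha (hm₂₁.dense_domain hd)
  have hc₂₁ := isClosable_of_isFormalAdjoint ha.symm (hm₁₂.dense_domain hd)
  obtain ⟨p, hp, hpX⟩ := hXm.exists_isKer hX.selfAdjoint.isClosed
  obtain ⟨p₁₂, hp₁₂, he₁₂⟩ := hm₁₂.exists_isKer_closure hd hc₁₂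
  obtain ⟨p₂₁, hp₂₁, he₂₁⟩ := hm₂₁.exists_isKer_closure hd hc₂₁
  refine ⟨q₁, q₂, h₁, h₂, ⟨hm₁₂.dense_domain hd, hc₁₂⟩, ⟨hm₂₁.dense_domain hd, hc₂₁⟩, p, p₁₂, p₂₁,
    hp, hp₁₂, hp₂₁, ?_, ?_, k, ?_, ?_⟩
  · by_contra hE
    obtain ⟨q, hqp, hqe⟩ := exists_dim_kernel_compression_eq_add_one hτ hXm h₂ he₁₂ hE
    exact hk' ⟨q₁, q, h₁, hqp, by rw [Nat.cast_succ, ← add_assoc, ← hq]; exact hqe⟩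
  -- `P` quantifies over ordered pairs, so the pair `(q₂, q)` with the roles exchanged contradicts
  -- maximality just as well.
  · by_contra hE
    obtain ⟨q, hqp, hqe⟩ := exists_dim_kernel_compression_eq_add_one hτ hXm h₁ he₂₁ hE
    exact hk' ⟨q₂, q, h₂, hqp, by rw [Nat.cast_succ, ← add_assoc, ← hq']; exact hqe⟩
  · rw [card_mul_traceMat_of_isStarProjection hτ hp₁₂.isStarProjection,
      card_mul_traceMat_of_isStarProjection hτ hp.isStarProjection, he₁₂, hpX]
    change ((δ q₁ q₂ : ℝ) : ℂ) - (dim (opTrace τ) (kernel X) : ℂ) = _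
    rw [hq]
    push_cast
    ring
  · rw [card_mul_traceMat_of_isStarProjection hτ hp₂₁.isStarProjection,
      card_mul_traceMat_of_isStarProjection hτ hp.isStarProjection, he₂₁, hpX]
    change ((δ q₂ q₁ : ℝ) : ℂ) - (dim (opTrace τ) (kernel X) : ℂ) = _
    rw [hq']
    push_cast
    ring
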